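/- Let $n=m+2\ge 2$. A lightlike hypersurface $V$ (with $\dim V=n-1$) of a Lorentzian manifold $(M,g)$, $\dim M=n$, $\operatorname{sign} g=(n-1,1)$, is a smooth immersed hypersurface on each of whose tangent spaces $g$ is degenerate; the $g$-radical of $T_xV$ is then a line, tangent to the isotropic geodesic of $V$ through $x$. A first-order isotropic frame at $x\in V$ consists of a basis $e_1,e_a$ ($a=2,\dots,n-1$) of $T_xV$ with $e_1$ isotropic and orthogonal to $T_xV$, and an isotropic $e_n\in T_xM$ with $(e_n,e_a)=0$, $(e_1,e_n)=-1$. A screen distribution on $V$ is a smooth $(n-2)$-dimensional distribution $S\subset TV$ complementary to the isotropic direction in each $T_xV$; its normalizing line $N_x\subset T_xM$ is the isotropic line orthogonal to $S_x$ and not tangent to $V$; the induced affine connection on $V$ is the Levi-Civita derivative followed by the projection of $T_xM$ onto $T_xV$ along $N_x$. An absolute invariant is a rule $J$ which assigns to each lightlike hypersurface $V$ of a given class a smooth function $J$ on $V$ (independent of frames). It is intrinsic if it is preserved by local isometries of the ambient manifolds that map hypersurfaces of the class to each other; similarly for distributions. An object has order (at most) $q$, or is defined in a neighborhood of order $q$,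 if its components in coordinate systems of $M$ and $V$ are given by one smooth function, on an open set of jets, of the derivatives of order $\le q$ of the parametric equations of $V$ and the derivatives of order $\le q-1$ of the components $g_{ij}$, at the point. The coordinate systems of the ambient manifolds are taken from a fixed collection, the same for all objects considered. **Theorem 5.** Let $J$ be an absolute invariant such that on every $V$ of the class the level submanifolds of $J$ are transversal to the isotropic geodesics, i.e. the derivative of $J$ along isotropic directions is nowhere zero. Then: (a) The distribution $S$ tangent to the level submanifolds ($S_x=\ker dJ_x$) is a screen distribution. It is invariant: if $dJ=K\omega^1+\widetilde K_a\omega^a$ in an isotropic frame with dual coframe $\omega^1,\omega^a$ on $V$, then $S_x$ is spanned by $e_a+K_ae_1$, $K_a=-\widetilde K_a/K$, whatever the frame. At each point there is exactly one normalizing line $N_x$, so that the projection of $T_xV$ onto $S_x$ along the isotropic direction and that of $T_xM$ onto $T_xV$ along $N_x$ are well defined. (b) If $J$ is intrinsic, so is $S$. (c) If $J$ has order $p$, then the normalization (these two projections) is defined in a neighborhood of order $p+1$, and, if $p\ge 1$, the curvature tensor of the induced connection is defined in a neighborhood of order $p+2$. (d) For every smooth local field of isotropic frames with $e_a\in S$,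 the connection forms, defined by $\nabla e_a=\omega_a^1e_1+\omega_a^be_b+\omega_a^ne_n$ ($\nabla$ the Levi-Civita connection along $V$), satisfy $\omega_a^1=\nu_a\omega^1+\nu_{ab}\omega^b$ with $\nu_{ab}=\nu_{ba}$. -/

import Mathlib

open Set Filter Topology Bundle
open scoped Manifold ContDiff

universe u

noncomputable section

/-- The model space `ℝᵏ`. -/
abbrev Coord (k : ℕ) : Type := EuclideanSpace ℝ (Fin k)

/-- Bilinear forms on `ℝᵏ`. -/
abbrev BilForm (k : ℕ) : Type := Coord k →L[ℝ] Coord k →L[ℝ] ℝ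

instance (k : ℕ) : NormedAddCommGroup (BilForm k) := ContinuousLinearMap.toNormedAddCommGroup

instance (k : ℕ) : NormedSpace ℝ (BilForm k) := ContinuousLinearMap.toNormedSpace

/-- A (bundled) smooth manifold of dimension `k`, without boundary. -/
structure SmoothMfd (k : ℕ) : Type (u + 1) where
  carrier : Type u
  [top : TopologicalSpace carrier]
  [charted : ChartedSpace (Coord k) carrier]
  [smooth : IsManifold 𝓘(ℝ, Coord k) ∞ carrier]

namespace SmoothMfd

instance (k : ℕ) : CoeSort (SmoothMfd.{u} k) (Type u) := ⟨SmoothMfd.carrier⟩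

attribute [instance] SmoothMfd.top SmoothMfd.charted SmoothMfd.smooth

variable {k : ℕ}

/-- The tangent space at a point. -/
abbrev T (M : SmoothMfd.{u} k) (x : M) : Type := TangentSpace 𝓘(ℝ, Coord k) x

/-- The smooth coordinate systems (charts) of a manifold. -/
def charts (M : SmoothMfd.{u} k) : Set (OpenPartialHomeomorph M (Coord k)) :=
  IsManifold.maximalAtlas 𝓘(ℝ, Coord k) ∞ M

/-- Components of tangent vectors at `x` in the coordinate system `κ`. -/
def toCoord (M : SmoothMfd.{u} k) (κ : OpenPartialHomeomorph M (Coord k)) (x : M) :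
    M.T x →L[ℝ] Coord k :=
  mfderiv 𝓘(ℝ, Coord k) 𝓘(ℝ, Coord k) κ x

/-- The tangent vector at `x` with given components in the coordinate system `κ`. -/
def ofCoord (M : SmoothMfd.{u} k) (κ : OpenPartialHomeomorph M (Coord k)) (x : M) :
    Coord k →L[ℝ] M.T x :=
  (M.toCoord κ x).inverse

/-- Smoothness of a tangent vector field on a set. -/
def SmoothFieldOn (M : SmoothMfd.{u} k) (X : ∀ x : M, M.T x) (O : Set M) : Prop :=
  ContMDiffOn 𝓘(ℝ, Coord k) (𝓘(ℝ, Coord k).prod 𝓘(ℝ, Coord k)) ∞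
    (fun x => (⟨x, X x⟩ : TangentBundle 𝓘(ℝ, Coord k) M)) O

end SmoothMfd

/-- A smooth pseudo-Riemannian metric of Lorentzian signature `(n - 1, 1)`, `n = m + 2`. -/
structure LorentzMetric {m : ℕ} (M : SmoothMfd.{u} (m + 2)) where
  form : ∀ x : M, M.T x →L[ℝ] M.T x →L[ℝ] ℝ
  contMDiff : ContMDiff 𝓘(ℝ, Coord (m + 2))
    (𝓘(ℝ, Coord (m + 2)).prod 𝓘(ℝ, BilForm (m + 2))) ∞
    (fun x : M => TotalSpace.mk' (BilForm (m + 2))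
      (E := fun x : M => M.T x →L[ℝ] M.T x →L[ℝ] ℝ) x (form x))
  signature : ∀ x : M, ∃ b : Module.Basis (Fin (m + 2)) ℝ (M.T x), ∀ i j,
    form x (b i) (b j) = if i = j then (if i = Fin.last (m + 1) then -1 else 1) else 0

/-- The matrix of the metric in a coordinate system, as a bilinear-form-valued function of the
coordinates. -/
def LorentzMetric.inCoord {m : ℕ} {M : SmoothMfd.{u} (m + 2)} (g : LorentzMetric M)
    (κ : OpenPartialHomeomorph M (Coord (m + 2))) :
    Coord (m + 2) → BilForm (m + 2) := fun y =>
  let B : BilForm (m + 2) := g.form (κ.symm y)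
  let A : Coord (m + 2) →L[ℝ] Coord (m + 2) := M.ofCoord κ (κ.symm y)
  B.bilinearComp A A

/-- The Christoffel map `Γ(v, w)` of the Levi-Civita connection of a metric given in coordinates:
`2 g(Γ(v, w), z) = ∂_v g(w, z) + ∂_w g(v, z) - ∂_z g(v, w)` for all `z`. -/
def christoffel {E : Type} [NormedAddCommGroup E] [NormedSpace ℝ E]
    (g : E → E →L[ℝ] E →L[ℝ] ℝ) (y v w : E) : E :=
  (g y).inverse ((1 / 2 : ℝ) •
    (fderiv ℝ g y v w + fderiv ℝ g y w v - ((fderiv ℝ g y).flip v).flip w))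

/-- A lightlike hypersurface `V` of an `n`-dimensional Lorentzian manifold `(M, g)`, `n = m + 2`:
a smooth immersed hypersurface on all of whose tangent spaces the metric is degenerate. -/
structure LightlikeHypersurface (m : ℕ) : Type (u + 1) where
  M : SmoothMfd.{u} (m + 2)
  g : LorentzMetric M
  V : SmoothMfd.{u} (m + 1)
  ι : V → M
  contMDiff : ContMDiff 𝓘(ℝ, Coord (m + 1)) 𝓘(ℝ, Coord (m + 2)) ∞ ι
  immersive : ∀ x, Function.Injective (mfderiv 𝓘(ℝ, Coord (m + 1)) 𝓘(ℝ, Coord (m + 2)) ι x)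
  lightlike : ∀ x, ∃ ξ : V.T x, ξ ≠ 0 ∧ ∀ w : V.T x,
    g.form (ι x) (mfderiv 𝓘(ℝ, Coord (m + 1)) 𝓘(ℝ, Coord (m + 2)) ι x ξ)
      (mfderiv 𝓘(ℝ, Coord (m + 1)) 𝓘(ℝ, Coord (m + 2)) ι x w) = 0

namespace LightlikeHypersurface

variable {m : ℕ} (H : LightlikeHypersurface.{u} m)

/-- The inclusion `T_x V → T_x M`. -/
def dι (x : H.V) : H.V.T x →L[ℝ] H.M.T (H.ι x) :=
  mfderiv 𝓘(ℝ, Coord (m + 1)) 𝓘(ℝ, Coord (m + 2)) H.ι x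

/-- The scalar product of the ambient manifold at a point of `V`. -/
def scal (x : H.V) (X Y : H.M.T (H.ι x)) : ℝ := H.g.form (H.ι x) X Y

/-- The isotropic direction of `T_x V`, i.e. the tangent line at `x` to the isotropic geodesic of
`V` through `x`: the vectors of `T_x V` orthogonal to all of `T_x V`. -/
def isotropic (x : H.V) : Submodule ℝ (H.V.T x) where
  carrier := {ξ | ∀ w, H.scal x (H.dι x ξ) (H.dι x w) = 0}
  add_mem' := by
    intro a b ha hb w
    have h1 := ha w
    have h2 := hb w
    simp only [scal, map_add, add_apply] at h1 h2 ⊢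
    rw [h1, h2, add_zero]
  zero_mem' := by intro w; simp [scal]
  smul_mem' := by
    intro c a ha w
    have h1 := ha w
    simp only [scal, map_smul, smul_apply] at h1 ⊢
    rw [h1, smul_zero]

/-- The isotropic first-order frames `(e₁, e_a, e_n)` at a point of `V`: `e₁` is isotropic and
tangent to `V`, `e₁, e_a` is a basis of `T_x V`, `e_n` is isotropic, orthogonal to the `e_a`, and
`(e₁, e_n) = -1`. -/
structure IsotropicFrame (x : H.V) where
  e₁ : H.V.T x
  e : Fin m → H.V.T x
  en : H.M.T (H.ι x)
  linearIndependent : LinearIndependent ℝ (Fin.cons e₁ e : Fin (m + 1) → H.V.T x)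
  e₁_mem : e₁ ∈ H.isotropic x
  en_isotropic : H.scal x en en = 0
  en_e₁ : H.scal x (H.dι x e₁) en = -1
  en_e : ∀ a, H.scal x (H.dι x (e a)) en = 0

/-- A distribution on `V`: a subspace of every tangent space. -/
abbrev Dist := ∀ x : H.V, Submodule ℝ (H.V.T x)

/-- A screen distribution: a smooth `(n - 2)`-dimensional distribution, complementary in every
`T_x V` to the isotropic direction. -/
def IsScreenDistribution (S : H.Dist) : Prop :=
  (∀ x, IsCompl (H.isotropic x) (S x)) ∧
  ∀ x₀ : H.V, ∃ O : Set H.V, IsOpen O ∧ x₀ ∈ O ∧ ∃ X : Fin m → ∀ x : H.V, H.V.T x,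
    (∀ a, H.V.SmoothFieldOn (X a) O) ∧
    ∀ x ∈ O, LinearIndependent ℝ (fun a => X a x) ∧
      Submodule.span ℝ (range fun a => X a x) = S x

/-- The subspace spanned by `c_a = e_a + z_a e₁`, for a frame and quantities `z_a`. -/
def IsotropicFrame.screen {H : LightlikeHypersurface.{u} m} {x : H.V} (f : H.IsotropicFrame x)
    (z : Fin m → ℝ) : Submodule ℝ (H.V.T x) :=
  Submodule.span ℝ (range fun a => f.e a + z a • f.e₁)

/-- Quantities `z_a`, depending on the isotropic frame, form a normalizing object: the screen
subspace spanned by the `e_a + z_a e₁` is invariant, i.e. independent of the choice of the frame. -/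
def IsNormalizingObject (x : H.V) (z : H.IsotropicFrame x → Fin m → ℝ) : Prop :=
  ∀ f f' : H.IsotropicFrame x, f.screen (z f) = f'.screen (z f')

/-- `N` spans the normalizing isotropic line of the screen distribution `S` at `x`: it is isotropic,
orthogonal to `S_x`, and not tangent to `V`. -/
def IsNormalizing (S : H.Dist) (x : H.V) (N : H.M.T (H.ι x)) : Prop :=
  H.scal x N N = 0 ∧ (∀ s ∈ S x, H.scal x N (H.dι x s) = 0) ∧ ∀ v, H.dι x v ≠ N

/-- The projection of `T_x V` onto the screen subspace along the isotropic direction. -/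
def IsScreenProjection (S : H.Dist) (x : H.V) (P : H.V.T x →L[ℝ] H.V.T x) : Prop :=
  (∀ s ∈ S x, P s = s) ∧ ∀ ξ ∈ H.isotropic x, P ξ = 0

/-- The projection of `T_x M` onto `T_x V` along the normalizing isotropic line. -/
def IsTangentialProjection (S : H.Dist) (x : H.V) (Q : H.M.T (H.ι x) →L[ℝ] H.V.T x) : Prop :=
  (∀ v, Q (H.dι x v) = v) ∧ ∀ N, H.IsNormalizing S x N → Q N = 0

open Classical in
/-- The projection onto the screen subspace (zero if there is none). -/
def screenProjection (S : H.Dist) (x : H.V) : H.V.T x →L[ℝ] H.V.T x :=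
  if h : ∃ P, H.IsScreenProjection S x P then h.choose else 0

open Classical in
/-- The projection along the normalizing isotropic line (zero if there is none). -/
def tangentialProjection (S : H.Dist) (x : H.V) : H.M.T (H.ι x) →L[ℝ] H.V.T x :=
  if h : ∃ Q, H.IsTangentialProjection S x Q then h.choose else 0

/-- Coordinate systems on the ambient manifold. -/
abbrev AmbientChart := OpenPartialHomeomorph H.M (Coord (m + 2))

/-- Coordinate systems on the hypersurface. -/
abbrev Chart := OpenPartialHomeomorph H.V (Coord (m + 1))

/-- The parametric equations of `V`: the inclusion, in coordinates. -/
def ιInCoord (κ : H.AmbientChart) (χ : H.Chart) : Coord (m + 1) → Coord (m + 2) :=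
  fun u => κ (H.ι (χ.symm u))

/-- The Levi-Civita covariant derivative, in direction `v ∈ T_x V`, of a field `X` of tangent
vectors of `M` along `V`, computed in coordinates. -/
def leviCivita (κ : H.AmbientChart) (χ : H.Chart) (X : ∀ x : H.V, H.M.T (H.ι x)) (x : H.V)
    (v : H.V.T x) : H.M.T (H.ι x) :=
  H.M.ofCoord κ (H.ι x)
    (fderiv ℝ (fun u => H.M.toCoord κ (H.ι (χ.symm u)) (X (χ.symm u))) (χ x) (H.V.toCoord χ x v)
      + christoffel (H.g.inCoord κ) (κ (H.ι x)) (H.M.toCoord κ (H.ι x) (H.dι x v))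
          (H.M.toCoord κ (H.ι x) (X x)))

/-- The affine connection on `V` induced by the screen distribution `S`: the Levi-Civita derivative
followed by the projection onto `T_x V` along the normalizing isotropic line. -/
def inducedConnection (S : H.Dist) (κ : H.AmbientChart) (χ : H.Chart) (Y : ∀ x : H.V, H.V.T x)
    (x : H.V) (v : H.V.T x) : H.V.T x :=
  H.tangentialProjection S x (H.leviCivita κ χ (fun x' => H.dι x' (Y x')) x v)

/-- The coordinate vector field on `V` with constant components `w`. -/
def coordField (χ : H.Chart) (w : Coord (m + 1)) (x : H.V) : H.V.T x := H.V.ofCoord χ x w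

/-- The components in the coordinate system `χ` of the curvature tensor
`R(v, w)z = ∇_v ∇_w z - ∇_w ∇_v z - ∇_{[v, w]} z` of the induced connection, where `v, w, z`
are extended to (commuting) coordinate vector fields. -/
def inducedCurvature (S : H.Dist) (κ : H.AmbientChart) (χ : H.Chart) (v w z : Coord (m + 1))
    (x : H.V) : Coord (m + 1) :=
  let nabla := H.inducedConnection S κ χ
  H.V.toCoord χ x
    (nabla (fun x' => nabla (H.coordField χ z) x' (H.coordField χ w x')) x (H.coordField χ v x)
      - nabla (fun x' => nabla (H.coordField χ z) x' (H.coordField χ v x')) x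
          (H.coordField χ w x))

/-- The matrix of the screen projection in the coordinate system `χ`. -/
def screenProjectionInCoord (S : H.Dist) (χ : H.Chart) (x : H.V) :
    Coord (m + 1) →L[ℝ] Coord (m + 1) :=
  (H.V.toCoord χ x).comp ((H.screenProjection S x).comp (H.V.ofCoord χ x))

/-- The matrix of the projection along the normalizing lines in the coordinate systems `κ, χ`. -/
def tangentialProjectionInCoord (S : H.Dist) (κ : H.AmbientChart) (χ : H.Chart) (x : H.V) :
    Coord (m + 2) →L[ℝ] Coord (m + 1) :=
  (H.V.toCoord χ x).comp ((H.tangentialProjection S x).comp (H.M.ofCoord κ (H.ι x)))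

/-- A field of isotropic frames is smooth on a set. -/
def SmoothFramesOn (f : ∀ x : H.V, H.IsotropicFrame x) (O : Set H.V) : Prop :=
  H.V.SmoothFieldOn (fun x => (f x).e₁) O ∧ (∀ a, H.V.SmoothFieldOn (fun x => (f x).e a) O) ∧
  ContMDiffOn 𝓘(ℝ, Coord (m + 1)) (𝓘(ℝ, Coord (m + 2)).prod 𝓘(ℝ, Coord (m + 2))) ∞
    (fun x => (⟨H.ι x, (f x).en⟩ : TangentBundle 𝓘(ℝ, Coord (m + 2)) H.M)) O

/-- At the point `x`, the quantities `ν_a, ν_ab` are the coefficients of the connection forms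
`ω_a¹ = ν_a ω¹ + ν_ab ωᵇ` of the field of isotropic frames `f`. The forms `ω_aʲ` are defined by
`∇e_a = ω_a¹ e₁ + ω_aᵇ e_b + ω_aⁿ e_n`, and `t = ω¹(v)`, `s_b = ωᵇ(v)` for `v = t e₁ + s_b e_b`. -/
def IsConnectionCoeff (κ : H.AmbientChart) (χ : H.Chart) (f : ∀ x : H.V, H.IsotropicFrame x)
    (x : H.V) (ν : Fin m → ℝ) (ν₂ : Fin m → Fin m → ℝ) : Prop :=
  ∀ (a : Fin m) (t : ℝ) (s : Fin m → ℝ), ∃ (c : Fin m → ℝ) (d : ℝ),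
    H.leviCivita κ χ (fun x' => H.dι x' ((f x').e a)) x (t • (f x).e₁ + ∑ b, s b • (f x).e b) =
      (ν a * t + ∑ b, ν₂ a b * s b) • H.dι x (f x).e₁ + ∑ b, c b • H.dι x ((f x).e b)
        + d • (f x).en

/-- The differential of a function on `V`. -/
def d (J : H.V → ℝ) (x : H.V) : H.V.T x →L[ℝ] ℝ := mfderiv 𝓘(ℝ, Coord (m + 1)) 𝓘(ℝ, ℝ) J x

/-- The level submanifolds of `J` are transversal to the isotropic geodesics: the derivative of `J`
in the direction of each isotropic geodesic is nowhere zero. -/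
def LevelsTransversal (J : H.V → ℝ) : Prop :=
  ∀ x, ∀ ξ ∈ H.isotropic x, ξ ≠ 0 → H.d J x ξ ≠ 0

/-- The vectors tangent at `x` to the level set of `J` through `x`: velocities of smooth curves in
the level set. -/
def levelTangent (J : H.V → ℝ) (x : H.V) : Set (H.V.T x) :=
  {v | ∃ γ : ℝ → H.V, γ 0 = x ∧ ContMDiffAt 𝓘(ℝ, ℝ) 𝓘(ℝ, Coord (m + 1)) ∞ γ 0 ∧
    (∀ᶠ t in 𝓝 0, J (γ t) = J x) ∧
    (mfderiv 𝓘(ℝ, ℝ) 𝓘(ℝ, Coord (m + 1)) γ 0 (1 : ℝ) : Coord (m + 1)) = v}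

/-- The distribution of the kernels of `dJ`. -/
def levelDist (J : H.V → ℝ) : H.Dist := fun x => LinearMap.ker (H.d J x).toLinearMap

/-- A local isometry between Lorentzian manifolds carrying (an open part of) a lightlike
hypersurface onto (an open part of) another one. -/
structure LocalIsometry (H H' : LightlikeHypersurface.{u} m) where
  Φ : OpenPartialHomeomorph H.M H'.M
  Ψ : OpenPartialHomeomorph H.V H'.V
  smooth_Φ : ContMDiffOn 𝓘(ℝ, Coord (m + 2)) 𝓘(ℝ, Coord (m + 2)) ∞ Φ Φ.source
  smooth_Φ_symm : ContMDiffOn 𝓘(ℝ, Coord (m + 2)) 𝓘(ℝ, Coord (m + 2)) ∞ Φ.symm Φ.target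
  smooth_Ψ : ContMDiffOn 𝓘(ℝ, Coord (m + 1)) 𝓘(ℝ, Coord (m + 1)) ∞ Ψ Ψ.source
  smooth_Ψ_symm : ContMDiffOn 𝓘(ℝ, Coord (m + 1)) 𝓘(ℝ, Coord (m + 1)) ∞ Ψ.symm Ψ.target
  isometric : ∀ y ∈ Φ.source, ∀ v w : H.M.T y,
    H'.g.form (Φ y) (mfderiv 𝓘(ℝ, Coord (m + 2)) 𝓘(ℝ, Coord (m + 2)) Φ y v)
      (mfderiv 𝓘(ℝ, Coord (m + 2)) 𝓘(ℝ, Coord (m + 2)) Φ y w) = H.g.form y v w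
  maps : ∀ x ∈ Ψ.source, H.ι x ∈ Φ.source ∧ H'.ι (Ψ x) = Φ (H.ι x)

end LightlikeHypersurface

section Invariants

variable {m : ℕ}

/-- A rule assigning to every lightlike hypersurface a function on it (only its values on a
prescribed class of hypersurfaces matter). Since its value depends only on the point of `V`, and not
on an isotropic frame at that point, this is an absolute invariant. -/
abbrev AbsoluteInvariant (m : ℕ) := ∀ H : LightlikeHypersurface.{u} m, H.V → ℝ

/-- An invariant is intrinsically connected with the hypersurfaces of the class `𝒞`: it is preserved
by the local isometries of the ambient manifolds. -/
def AbsoluteInvariant.IsIntrinsic (𝒞 : Set (LightlikeHypersurface.{u} m))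
    (J : AbsoluteInvariant.{u} m) : Prop :=
  ∀ H ∈ 𝒞, ∀ H' ∈ 𝒞, ∀ L : LightlikeHypersurface.LocalIsometry H H',
    ∀ x ∈ L.Ψ.source, J H' (L.Ψ x) = J H x

/-- A rule assigning to every lightlike hypersurface a distribution on it is intrinsic: it is
preserved by the local isometries of the ambient manifolds. -/
def IsIntrinsicDistribution (𝒞 : Set (LightlikeHypersurface.{u} m))
    (S : ∀ H : LightlikeHypersurface.{u} m, H.Dist) : Prop :=
  ∀ H ∈ 𝒞, ∀ H' ∈ 𝒞, ∀ L : LightlikeHypersurface.LocalIsometry H H', ∀ x ∈ L.Ψ.source,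
    (S H x).map (mfderiv 𝓘(ℝ, Coord (m + 1)) 𝓘(ℝ, Coord (m + 1)) L.Ψ x).toLinearMap
      = S H' (L.Ψ x)

/-- Coordinates of a differential neighborhood of order `q`: the derivatives up to order `q` of the
parametric equations of a hypersurface, and the derivatives up to order `q - 1` of the components of
the metric (the components `g_ij` themselves belong to the first-order neighborhood). -/
abbrev JetSpace (m q : ℕ) : Type :=
  ((k : Fin (q + 1)) → Coord (m + 1) [×(k : ℕ)]→L[ℝ] Coord (m + 2)) ×
  ((k : Fin q) → Coord (m + 2) [×(k : ℕ)]→L[ℝ] BilForm (m + 2))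

/-- The `q`-th order neighborhood of the point `x` of a hypersurface, in coordinates. -/
def LightlikeHypersurface.jet (H : LightlikeHypersurface.{u} m) (q : ℕ) (κ : H.AmbientChart)
    (χ : H.Chart) (x : H.V) : JetSpace m q :=
  (fun k => iteratedFDeriv ℝ k (H.ιInCoord κ χ) (χ x),
   fun k => iteratedFDeriv ℝ k (H.g.inCoord κ) (κ (H.ι x)))

/-- An object given on all hypersurfaces of the class `𝒞` by its components `T H κ χ x` with respect
to coordinate systems `κ` of the ambient manifold and `χ` of the hypersurface is defined in a
neighborhood of order `q`: its components are given by one smooth function of the `q`-jets. The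
coordinate systems `κ` range over a prescribed collection `𝒦`; this may consist of all coordinate
systems of all ambient manifolds, or, for objects depending on additional data given on a fixed
ambient manifold, of a single one. -/
def HasOrder {W : Type} [NormedAddCommGroup W] [NormedSpace ℝ W]
    (𝒞 : Set (LightlikeHypersurface.{u} m))
    (𝒦 : ∀ M : SmoothMfd.{u} (m + 2), Set (OpenPartialHomeomorph M (Coord (m + 2)))) (q : ℕ)
    (T : ∀ H : LightlikeHypersurface.{u} m, H.AmbientChart → H.Chart → H.V → W) : Prop :=
  ∃ (U : Set (JetSpace m q)) (F : JetSpace m q → W), IsOpen U ∧ ContDiffOn ℝ ∞ F U ∧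
    ∀ H ∈ 𝒞, ∀ κ ∈ 𝒦 H.M, κ ∈ H.M.charts → ∀ χ ∈ H.V.charts,
      ∀ x ∈ χ.source, H.ι x ∈ κ.source → H.jet q κ χ x ∈ U ∧ T H κ χ x = F (H.jet q κ χ x)

end Invariants

end

/-!
Everything rests on linear algebra at a point. Let `A : F → E` be the inclusion of the tangent
hyperplane, `B` the scalar product and `l = dJ`, a covector that does not vanish on the radical of
`A^*B` (`IsLightlikeTriple`). The form `A^*B + l ⊗ l` is then nondegenerate, and its inverse takes
`l` to the radical vector `ξ` with `l ξ = 1` (`radicalVector`); so `v ↦ v - l v • ξ` is the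
projection onto `ker l` along the radical. A vector `N₀` with `B(N₀, A ·) = -l` exists, and
`N₀ + ½ B(N₀, N₀) A ξ` is isotropic (`nullNormal`); it spans the only isotropic line that is
orthogonal to `A (ker l)` and outside the hyperplane, hence the projection onto the hyperplane along
it (`tangentProj`). This gives the normalization. Since all these objects are obtained by inverting
linear maps, they depend analytically on `(A, B, l)`.

The orders follow. The components of `A` and `B` belong to the first-order neighborhood, and those
of `dJ` to the neighborhood of order `p + 1`, because the derivative along the hypersurface of an
object of order `q` is of order `q + 1` (`HasOrder.derivative`). An object that depends analytically
on objects of order `q` has order `q` (`HasOrder.comp`), which settles the projections. The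
Christoffel symbols of the induced connection involve in addition the second-order neighborhood, so
for `p ≥ 1` they still have order `p + 1` (`hasOrder_inducedConnection`), and the curvature, which
involves their first derivatives, has order `p + 2`.

The remaining claims reduce to the description of the distribution as `ker dJ`. In any isotropic
frame this kernel is spanned by `e_a - (dJ(e_a) / dJ(e₁)) e₁` by a dimension count; applied to
constant vector fields of a chart, the same formula yields smooth local bases. Every vector of the
kernel is the velocity of a curve in a level set, by the implicit function theorem. A local isometry
that preserves `J` intertwines the differentials. Finally, if the `e_a` are tangent to the level
submanifolds, so are their brackets `[e_b, e_a]`, which equal `∇_{e_b} e_a - ∇_{e_a} e_b` because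
the Levi-Civita connection is torsion-free; they have no component along `e₁`, and since the
`e₁`-component of a vector `X` is `-(X, e_n)`, this is the symmetry of `ν_ab`
(`IsChartPair.exists_connectionCoeff`).
-/

noncomputable section

set_option maxSynthPendingDepth 3

/-! ### Linear algebra of a degenerate hyperplane -/

section LinearAlgebra

theorem ContDiffAt.clm_flip {U V W : Type*} [NormedAddCommGroup U] [NormedSpace ℝ U]
    [NormedAddCommGroup V] [NormedSpace ℝ V] [NormedAddCommGroup W] [NormedSpace ℝ W]
    {Z : Type*} [NormedAddCommGroup Z] [NormedSpace ℝ Z] {n : ℕ∞ω} {z : Z}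
    {f : Z → U →L[ℝ] V →L[ℝ] W} (hf : ContDiffAt ℝ n f z) :
    ContDiffAt ℝ n (fun z => (f z).flip) z := by
  have hflip := LinearIsometryEquiv.contDiff (𝕜 := ℝ) (E := U →L[ℝ] V →L[ℝ] W)
    (F := V →L[ℝ] U →L[ℝ] W) (n := n) (ContinuousLinearMap.flipₗᵢ ℝ U V W)
  exact hflip.contDiffAt.comp z hf

theorem ContinuousLinearMap.isInvertible_of_injective_of_finrank_eq {V W : Type*}
    [NormedAddCommGroup V] [NormedSpace ℝ V] [FiniteDimensional ℝ V]
    [NormedAddCommGroup W] [NormedSpace ℝ W] [FiniteDimensional ℝ W] {f : V →L[ℝ] W}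
    (hf : Function.Injective f) (h : Module.finrank ℝ V = Module.finrank ℝ W) :
    f.IsInvertible :=
  ⟨(LinearEquiv.ofInjectiveOfFinrankEq f.toLinearMap hf h).toContinuousLinearEquiv, by
    ext x; rfl⟩

theorem finrank_continuousDual {V : Type*} [NormedAddCommGroup V] [NormedSpace ℝ V]
    [FiniteDimensional ℝ V] : Module.finrank ℝ (V →L[ℝ] ℝ) = Module.finrank ℝ V := by
  rw [← (LinearMap.toContinuousLinearMap (𝕜 := ℝ) (E := V) (F' := ℝ)).finrank_eq]
  exact Subspace.dual_finrank_eq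

variable {E F : Type*} [NormedAddCommGroup E] [InnerProductSpace ℝ E]
  [NormedAddCommGroup F] [NormedSpace ℝ F]

/-- The linear data of a lightlike hypersurface at a point: the inclusion `A` of its tangent space
as a hyperplane, the nondegenerate scalar product `B`, which is degenerate on the hyperplane, and
a covector `l` (the differential of the invariant) that does not vanish on the radical. -/
structure IsLightlikeTriple (A : F →L[ℝ] E) (B : E →L[ℝ] E →L[ℝ] ℝ) (l : F →L[ℝ] ℝ) : Prop where
  finrank_eq : Module.finrank ℝ E = Module.finrank ℝ F + 1
  injective : Function.Injective A
  symm : ∀ u v, B u v = B v u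
  nondegenerate : ∀ u, (∀ v, B u v = 0) → u = 0
  exists_radical : ∃ ξ ≠ 0, ∀ w, B (A ξ) (A w) = 0
  transversal : ∀ ξ, (∀ w, B (A ξ) (A w) = 0) → ξ ≠ 0 → l ξ ≠ 0

/-- The map `X ↦ B(X, A ·)`. -/
def conormal (A : F →L[ℝ] E) (B : E →L[ℝ] E →L[ℝ] ℝ) : E →L[ℝ] F →L[ℝ] ℝ :=
  (B.flip ∘L A).flip

/-- The form `A^*B + l ⊗ l`, which is nondegenerate although `A^*B` is not. -/
def screenForm (A : F →L[ℝ] E) (B : E →L[ℝ] E →L[ℝ] ℝ) (l : F →L[ℝ] ℝ) : F →L[ℝ] F →L[ℝ] ℝ :=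
  conormal A B ∘L A + l.smulRight l

/-- The radical vector `ξ` with `l ξ = 1`. It is the solution of `(A^*B + l ⊗ l) ξ = l`; this
formula, rather than a choice in the radical, makes its regularity in `(A, B, l)` apparent. -/
def radicalVector (A : F →L[ℝ] E) (B : E →L[ℝ] E →L[ℝ] ℝ) (l : F →L[ℝ] ℝ) : F :=
  (screenForm A B l).inverse l

/-- The projection onto `ker l` along the radical. -/
def screenProj (A : F →L[ℝ] E) (B : E →L[ℝ] E →L[ℝ] ℝ) (l : F →L[ℝ] ℝ) : F →L[ℝ] F :=
  ContinuousLinearMap.id ℝ F - l.smulRight (radicalVector A B l)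

/-- The map `X ↦ (B(X, A ·), ⟪A ξ, X⟫)`. The Euclidean product with `A ξ` serves to make
`X ↦ B(X, A ·)`, whose kernel is spanned by `A ξ`, invertible. -/
def conormalPair (A : F →L[ℝ] E) (B : E →L[ℝ] E →L[ℝ] ℝ) (l : F →L[ℝ] ℝ) :
    E →L[ℝ] (F →L[ℝ] ℝ) × ℝ :=
  ContinuousLinearMap.inl ℝ (F →L[ℝ] ℝ) ℝ ∘L conormal A B +
    ContinuousLinearMap.inr ℝ (F →L[ℝ] ℝ) ℝ ∘L innerSL ℝ (A (radicalVector A B l))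

/-- A vector, not necessarily isotropic, that is orthogonal to `A (ker l)` and has product `-1`
with `A ξ`. -/
def preNormal (A : F →L[ℝ] E) (B : E →L[ℝ] E →L[ℝ] ℝ) (l : F →L[ℝ] ℝ) : E :=
  (conormalPair A B l).inverse (-l, 0)

/-- The isotropic vector orthogonal to `A (ker l)` that has product `-1` with `A ξ`. -/
def nullNormal (A : F →L[ℝ] E) (B : E →L[ℝ] E →L[ℝ] ℝ) (l : F →L[ℝ] ℝ) : E :=
  preNormal A B l + ((1 / 2 : ℝ) * B (preNormal A B l) (preNormal A B l)) •
    A (radicalVector A B l)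

/-- The map `(v, c) ↦ A v + c N`. -/
def hyperplaneSum (A : F →L[ℝ] E) (N : E) : F × ℝ →L[ℝ] E :=
  A ∘L ContinuousLinearMap.fst ℝ F ℝ +
    (ContinuousLinearMap.snd ℝ F ℝ).smulRight N

/-- The projection onto the hyperplane along `nullNormal`: the first component of the inverse of
`(v, c) ↦ A v + c N`. -/
def tangentProj (A : F →L[ℝ] E) (B : E →L[ℝ] E →L[ℝ] ℝ) (l : F →L[ℝ] ℝ) : E →L[ℝ] F :=
  ContinuousLinearMap.fst ℝ F ℝ ∘L (hyperplaneSum A (nullNormal A B l)).inverse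

@[simp] theorem conormal_apply (A : F →L[ℝ] E) (B : E →L[ℝ] E →L[ℝ] ℝ) (X : E) (w : F) :
    conormal A B X w = B X (A w) := rfl

@[simp] theorem hyperplaneSum_apply (A : F →L[ℝ] E) (N : E) (p : F × ℝ) :
    hyperplaneSum A N p = A p.1 + p.2 • N := rfl

theorem screenForm_apply (A : F →L[ℝ] E) (B : E →L[ℝ] E →L[ℝ] ℝ) (l : F →L[ℝ] ℝ) (v w : F) :
    screenForm A B l v w = B (A v) (A w) + l v * l w := rfl

theorem screenProj_apply (A : F →L[ℝ] E) (B : E →L[ℝ] E →L[ℝ] ℝ) (l : F →L[ℝ] ℝ) (v : F) :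
    screenProj A B l v = v - l v • radicalVector A B l := rfl

theorem conormalPair_apply (A : F →L[ℝ] E) (B : E →L[ℝ] E →L[ℝ] ℝ) (l : F →L[ℝ] ℝ) (X : E) :
    conormalPair A B l X = (conormal A B X, inner ℝ (A (radicalVector A B l)) X) := by
  simp [conormalPair]

/-- A vector outside a hyperplane complements it. -/
theorem isInvertible_hyperplaneSum [FiniteDimensional ℝ E] [FiniteDimensional ℝ F]
    {A : F →L[ℝ] E} (hA : Function.Injective A)
    (hdim : Module.finrank ℝ E = Module.finrank ℝ F + 1) {N : E} (hN : ∀ v, A v ≠ N) :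
    (hyperplaneSum A N).IsInvertible := by
  refine ContinuousLinearMap.isInvertible_of_injective_of_finrank_eq ?_ (by simp [hdim])
  rw [injective_iff_map_eq_zero]
  rintro ⟨v, c⟩ h
  simp only [hyperplaneSum_apply] at h
  have hc : c = 0 := by
    by_contra hc
    refine hN (-(c⁻¹ • v)) ?_
    rw [map_neg, map_smul, eq_neg_of_add_eq_zero_left h, smul_neg, neg_neg, smul_smul,
      inv_mul_cancel₀ hc, one_smul]
  subst hc
  have : v = 0 := hA (by simpa using h)
  simp [this]

theorem screenProj_of_ker (A : F →L[ℝ] E) (B : E →L[ℝ] E →L[ℝ] ℝ) {l : F →L[ℝ] ℝ} {s : F}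
    (hs : l s = 0) : screenProj A B l s = s := by
  simp [screenProj_apply, hs]

namespace IsLightlikeTriple

variable {A : F →L[ℝ] E} {B : E →L[ℝ] E →L[ℝ] ℝ} {l : F →L[ℝ] ℝ} (h : IsLightlikeTriple A B l)
include h

theorem eq_zero_of_radical {v : F} (hv : ∀ w, B (A v) (A w) = 0) (hl : l v = 0) : v = 0 := by
  by_contra h0
  exact h.transversal v hv h0 hl

theorem isInvertible_form [FiniteDimensional ℝ E] : B.IsInvertible := by
  refine ContinuousLinearMap.isInvertible_of_injective_of_finrank_eq ?_ finrank_continuousDual.symm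
  rw [injective_iff_map_eq_zero]
  exact fun u hu => h.nondegenerate u fun v => by simp [hu]

variable [FiniteDimensional ℝ F]

theorem isInvertible_screenForm : (screenForm A B l).IsInvertible := by
  refine ContinuousLinearMap.isInvertible_of_injective_of_finrank_eq ?_ finrank_continuousDual.symm
  rw [injective_iff_map_eq_zero]
  intro v hv
  have hv' : ∀ w, B (A v) (A w) + l v * l w = 0 := fun w => by
    rw [← screenForm_apply, hv]; rfl
  obtain ⟨ξ, hξ0, hξ⟩ := h.exists_radical
  have hl : l v = 0 := by
    have := hv' ξ
    rw [h.symm, hξ v, zero_add] at this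
    exact (mul_eq_zero.1 this).resolve_right (h.transversal ξ hξ hξ0)
  exact h.eq_zero_of_radical (fun w => by simpa [hl] using hv' w) hl

theorem radicalVector_spec : (∀ w, B (A (radicalVector A B l)) (A w) = 0) ∧
    l (radicalVector A B l) = 1 := by
  obtain ⟨ξ, hξ0, hξ⟩ := h.exists_radical
  have hl := h.transversal ξ hξ hξ0
  have : radicalVector A B l = (l ξ)⁻¹ • ξ := by
    rw [radicalVector, h.isInvertible_screenForm.inverse_apply_eq]
    ext w
    rw [screenForm_apply]
    simp [hξ, hl]
  rw [this]
  exact ⟨fun w => by simp [hξ], by simp [hl]⟩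

theorem radicalVector_radical (w : F) : B (A (radicalVector A B l)) (A w) = 0 :=
  h.radicalVector_spec.1 w

theorem apply_radicalVector : l (radicalVector A B l) = 1 := h.radicalVector_spec.2

theorem radicalVector_ne_zero : radicalVector A B l ≠ 0 := fun h0 => by
  simpa [h0] using h.apply_radicalVector

theorem eq_smul_radicalVector {η : F} (hη : ∀ w, B (A η) (A w) = 0) :
    η = l η • radicalVector A B l := by
  rw [← sub_eq_zero]
  refine h.eq_zero_of_radical (fun w => ?_) ?_
  · simp [hη, h.radicalVector_radical]
  · simp [h.apply_radicalVector]

theorem screenProj_of_radical {η : F} (hη : ∀ w, B (A η) (A w) = 0) :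
    screenProj A B l η = 0 := by
  rw [screenProj_apply, ← h.eq_smul_radicalVector hη, sub_self]

/-- The projection onto `ker l` along the radical is determined by its values on both. -/
theorem screenProj_unique {P : F →L[ℝ] F} (hP : ∀ s, l s = 0 → P s = s)
    (hP' : ∀ η, (∀ w, B (A η) (A w) = 0) → P η = 0) : P = screenProj A B l := by
  ext v
  have h1 := hP (v - l v • radicalVector A B l) (by simp [h.apply_radicalVector])
  rw [map_sub, map_smul, hP' _ h.radicalVector_radical, smul_zero, sub_zero] at h1
  rw [h1, screenProj_apply]

theorem not_tangent_of_apply_ne_zero {N : E} (hN : B N (A (radicalVector A B l)) ≠ 0) (v : F) :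
    A v ≠ N := by
  rintro rfl
  rw [h.symm, h.radicalVector_radical] at hN
  exact hN rfl

variable [FiniteDimensional ℝ E]

theorem exists_decomposition {N : E} (hN : ∀ v, A v ≠ N) (X : E) :
    ∃ (v : F) (c : ℝ), X = A v + c • N := by
  obtain ⟨e, he⟩ := isInvertible_hyperplaneSum h.injective h.finrank_eq hN
  refine ⟨(e.symm X).1, (e.symm X).2, ?_⟩
  have : hyperplaneSum A N (e.symm X) = X := by rw [← he]; exact e.apply_symm_apply X
  rw [hyperplaneSum_apply] at this
  exact this.symm

/-- A vector outside the hyperplane is not orthogonal to the radical: otherwise the radical would be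
orthogonal to everything. -/
theorem apply_ne_zero_of_not_tangent {N : E} (hN : ∀ v, A v ≠ N) :
    B N (A (radicalVector A B l)) ≠ 0 := by
  intro h0
  refine h.radicalVector_ne_zero (h.injective ?_)
  rw [map_zero]
  refine h.nondegenerate _ fun X => ?_
  obtain ⟨v, c, rfl⟩ := h.exists_decomposition hN X
  rw [map_add, map_smul, h.radicalVector_radical, h.symm, h0, smul_zero, add_zero]

theorem isInvertible_conormalPair : (conormalPair A B l).IsInvertible := by
  refine ContinuousLinearMap.isInvertible_of_injective_of_finrank_eq ?_ ?_
  · rw [injective_iff_map_eq_zero]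
    intro X hX
    rw [conormalPair_apply, Prod.mk_eq_zero] at hX
    have hX1 : ∀ w, B X (A w) = 0 := fun w => by rw [← conormal_apply, hX.1]; rfl
    by_cases hT : ∀ v, A v ≠ X
    · exact absurd (hX1 _) (h.apply_ne_zero_of_not_tangent hT)
    · push Not at hT
      obtain ⟨v, rfl⟩ := hT
      have hv := h.eq_smul_radicalVector hX1
      have h2 := hX.2
      rw [hv, map_smul, inner_smul_right, mul_eq_zero] at h2
      rcases h2 with h2 | h2
      · rw [hv, h2, zero_smul, map_zero]
      · rw [inner_self_eq_zero] at h2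
        rw [hv, map_smul, h2, smul_zero]
  · rw [Module.finrank_prod, finrank_continuousDual, Module.finrank_self, h.finrank_eq]

theorem preNormal_apply (w : F) : B (preNormal A B l) (A w) = -l w := by
  have h1 : conormalPair A B l (preNormal A B l) = (-l, 0) :=
    h.isInvertible_conormalPair.self_apply_inverse _
  rw [conormalPair_apply, Prod.mk.injEq] at h1
  rw [← conormal_apply, h1.1]; rfl

theorem nullNormal_apply (w : F) : B (nullNormal A B l) (A w) = -l w := by
  simp [nullNormal, h.preNormal_apply, h.radicalVector_radical]

theorem nullNormal_isotropic : B (nullNormal A B l) (nullNormal A B l) = 0 := by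
  -- `B(N₀ + c A ξ, N₀ + c A ξ) = B(N₀, N₀) - 2 c`, as `B(N₀, A ξ) = -1`
  conv_lhs => rw [nullNormal]
  simp only [map_add, map_smul, add_apply, smul_apply, h.preNormal_apply,
    h.symm (A (radicalVector A B l)) (preNormal A B l), h.radicalVector_radical,
    h.apply_radicalVector, smul_eq_mul]
  ring

theorem nullNormal_not_tangent (v : F) : A v ≠ nullNormal A B l :=
  h.not_tangent_of_apply_ne_zero (by rw [h.nullNormal_apply, h.apply_radicalVector]; norm_num) v

/-- The isotropic normals of `A (ker l)` outside the hyperplane form one punctured line. -/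
theorem eq_smul_nullNormal {N : E} (h0 : B N N = 0) (hS : ∀ s, l s = 0 → B N (A s) = 0)
    (hN : ∀ v, A v ≠ N) : ∃ c : ℝ, c ≠ 0 ∧ N = c • nullNormal A B l := by
  obtain ⟨v, c, rfl⟩ := h.exists_decomposition h.nullNormal_not_tangent N
  have hc : c ≠ 0 := by
    rintro rfl
    exact hN v (by simp)
  -- the tangential part is orthogonal to `ker l`, hence to everything in the hyperplane
  have hv : ∀ w, B (A v) (A w) = 0 := by
    intro w
    have := hS (w - l w • radicalVector A B l) (by simp [h.apply_radicalVector])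
    simp only [map_add, map_smul, add_apply, smul_apply, map_sub, h.nullNormal_apply,
      h.symm (A v) (A (radicalVector A B l)), h.radicalVector_radical, h.apply_radicalVector,
      smul_eq_mul] at this
    linarith
  have hlv : l v = 0 := by
    simp only [map_add, map_smul, add_apply, smul_apply, h.nullNormal_isotropic, hv v,
      h.symm (A v) (nullNormal A B l), h.nullNormal_apply, smul_eq_mul] at h0
    have : c * l v = 0 := by linarith
    exact (mul_eq_zero.1 this).resolve_left hc
  exact ⟨c, hc, by rw [h.eq_zero_of_radical hv hlv]; simp⟩

theorem isInvertible_hyperplaneSum_nullNormal :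
    (hyperplaneSum A (nullNormal A B l)).IsInvertible :=
  isInvertible_hyperplaneSum h.injective h.finrank_eq h.nullNormal_not_tangent

theorem tangentProj_decomposition (v : F) (c : ℝ) :
    tangentProj A B l (A v + c • nullNormal A B l) = v := by
  have : (hyperplaneSum A (nullNormal A B l)).inverse (A v + c • nullNormal A B l) = (v, c) := by
    rw [h.isInvertible_hyperplaneSum_nullNormal.inverse_apply_eq, hyperplaneSum_apply]
  rw [tangentProj, ContinuousLinearMap.comp_apply, this]; rfl

theorem tangentProj_of_tangent (v : F) : tangentProj A B l (A v) = v := by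
  simpa using h.tangentProj_decomposition v 0

theorem tangentProj_nullNormal : tangentProj A B l (nullNormal A B l) = 0 := by
  simpa using h.tangentProj_decomposition 0 1

/-- The projection along the null normal is determined by its values on the hyperplane and on
the null normal. -/
theorem tangentProj_unique {Q : E →L[ℝ] F} (hQ : ∀ v, Q (A v) = v)
    (hQ' : Q (nullNormal A B l) = 0) : Q = tangentProj A B l := by
  ext X
  obtain ⟨v, c, rfl⟩ := h.exists_decomposition h.nullNormal_not_tangent X
  rw [h.tangentProj_decomposition, map_add, map_smul, hQ, hQ', smul_zero, add_zero]

end IsLightlikeTriple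

/-! ### Regularity of the projections as functions of the linear data -/

variable {Z : Type*} [NormedAddCommGroup Z] [NormedSpace ℝ Z] {n : ℕ∞ω} {z : Z}

theorem ContDiffAt.clm_inverse_apply {V W : Type*} [NormedAddCommGroup V] [NormedSpace ℝ V]
    [CompleteSpace V] [NormedAddCommGroup W] [NormedSpace ℝ W] {f : Z → V →L[ℝ] W} {y : Z → W}
    (hf : ContDiffAt ℝ n f z) (hy : ContDiffAt ℝ n y z) (hi : (f z).IsInvertible) :
    ContDiffAt ℝ n (fun z => (f z).inverse (y z)) z :=
  (hi.contDiffAt_map_inverse.comp z hf).clm_apply hy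

variable {A : Z → F →L[ℝ] E} {B : Z → E →L[ℝ] E →L[ℝ] ℝ} {l : Z → F →L[ℝ] ℝ}

theorem ContDiffAt.conormal (hA : ContDiffAt ℝ n A z) (hB : ContDiffAt ℝ n B z) :
    ContDiffAt ℝ n (fun z => _root_.conormal (A z) (B z)) z :=
  (hB.clm_flip.clm_comp hA).clm_flip

variable [FiniteDimensional ℝ F]

theorem ContDiffAt.radicalVector (hA : ContDiffAt ℝ n A z) (hB : ContDiffAt ℝ n B z)
    (hl : ContDiffAt ℝ n l z) (h : IsLightlikeTriple (A z) (B z) (l z)) :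
    ContDiffAt ℝ n (fun z => _root_.radicalVector (A z) (B z) (l z)) z := by
  refine ContDiffAt.clm_inverse_apply ?_ hl h.isInvertible_screenForm
  refine ((hA.conormal hB).clm_comp hA).add ?_
  exact hl.smulRight hl

theorem ContDiffAt.screenProj (hA : ContDiffAt ℝ n A z) (hB : ContDiffAt ℝ n B z)
    (hl : ContDiffAt ℝ n l z) (h : IsLightlikeTriple (A z) (B z) (l z)) :
    ContDiffAt ℝ n (fun z => _root_.screenProj (A z) (B z) (l z)) z :=
  contDiffAt_const.sub (hl.smulRight (hA.radicalVector hB hl h))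

variable [FiniteDimensional ℝ E]

theorem ContDiffAt.nullNormal (hA : ContDiffAt ℝ n A z) (hB : ContDiffAt ℝ n B z)
    (hl : ContDiffAt ℝ n l z) (h : IsLightlikeTriple (A z) (B z) (l z)) :
    ContDiffAt ℝ n (fun z => _root_.nullNormal (A z) (B z) (l z)) z := by
  have hξ := hA.clm_apply (hA.radicalVector hB hl h)
  have hN : ContDiffAt ℝ n (fun z => preNormal (A z) (B z) (l z)) z := by
    refine ContDiffAt.clm_inverse_apply ?_ (hl.neg.prodMk contDiffAt_const)
      h.isInvertible_conormalPair
    exact (contDiffAt_const.clm_comp (hA.conormal hB)).add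
      (contDiffAt_const.clm_comp (((innerSL ℝ).contDiff.contDiffAt).comp z hξ))
  exact hN.add ((contDiffAt_const.mul ((hB.clm_apply hN).clm_apply hN)).smul hξ)

theorem ContDiffAt.tangentProj (hA : ContDiffAt ℝ n A z) (hB : ContDiffAt ℝ n B z)
    (hl : ContDiffAt ℝ n l z) (h : IsLightlikeTriple (A z) (B z) (l z)) :
    ContDiffAt ℝ n (fun z => _root_.tangentProj (A z) (B z) (l z)) z := by
  refine contDiffAt_const.clm_comp ?_
  refine h.isInvertible_hyperplaneSum_nullNormal.contDiffAt_map_inverse.comp z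
    (f := fun z => hyperplaneSum (A z) (_root_.nullNormal (A z) (B z) (l z))) ?_
  exact (hA.clm_comp contDiffAt_const).add
    (contDiffAt_const.smulRight (hA.nullNormal hB hl h))

end LinearAlgebra

/-! ### Components of tangent vectors in a chart -/

namespace SmoothMfd

variable {k : ℕ} {M : SmoothMfd.{u} k} {κ : OpenPartialHomeomorph M (Coord k)}

theorem mdifferentiable_of_mem_charts (hκ : κ ∈ M.charts) :
    κ.MDifferentiable 𝓘(ℝ, Coord k) 𝓘(ℝ, Coord k) :=
  ⟨(contMDiffOn_of_mem_maximalAtlas hκ).mdifferentiableOn (by simp),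
    (contMDiffOn_symm_of_mem_maximalAtlas hκ).mdifferentiableOn (by simp)⟩

/-- In the definition of `ofCoord` as an inverse the junk value does not occur in the source of a
chart. The ascription identifies the tangent space at `x` with the model space, so as to avoid a
transport along `κ.symm (κ x) = x`. -/
theorem ofCoord_eq_mfderiv_symm (hκ : κ ∈ M.charts) {x : M} (hx : x ∈ κ.source) :
    (M.ofCoord κ x : Coord k →L[ℝ] Coord k) =
      mfderiv 𝓘(ℝ, Coord k) 𝓘(ℝ, Coord k) κ.symm (κ x) := by
  have h := (mdifferentiable_of_mem_charts hκ).comp_symm_deriv (κ.map_source hx)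
  have h' := (mdifferentiable_of_mem_charts hκ).symm_comp_deriv hx
  rw [κ.left_inv hx] at h
  exact ContinuousLinearMap.inverse_eq h h'

theorem ofCoord_toCoord (hκ : κ ∈ M.charts) {x : M} (hx : x ∈ κ.source) (v : M.T x) :
    M.ofCoord κ x (M.toCoord κ x v) = v := by
  have h := (mdifferentiable_of_mem_charts hκ).symm_comp_deriv hx
  have h1 := ofCoord_eq_mfderiv_symm hκ hx
  have h2 : (M.ofCoord κ x : Coord k →L[ℝ] Coord k) (M.toCoord κ x v) =
    mfderiv 𝓘(ℝ, Coord k) 𝓘(ℝ, Coord k) κ.symm (κ x) (M.toCoord κ x v) :=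
    DFunLike.congr_fun h1 _
  exact h2.trans (DFunLike.congr_fun h v)

theorem toCoord_ofCoord (hκ : κ ∈ M.charts) {x : M} (hx : x ∈ κ.source) (w : Coord k) :
    M.toCoord κ x (M.ofCoord κ x w) = w := by
  have h := (mdifferentiable_of_mem_charts hκ).comp_symm_deriv (κ.map_source hx)
  rw [κ.left_inv hx] at h
  have h1 := ofCoord_eq_mfderiv_symm hκ hx
  have h2 : (M.toCoord κ x : Coord k →L[ℝ] Coord k) (M.ofCoord κ x w) =
    M.toCoord κ x (mfderiv 𝓘(ℝ, Coord k) 𝓘(ℝ, Coord k) κ.symm (κ x) w) :=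
    congrArg (M.toCoord κ x : Coord k →L[ℝ] Coord k) (DFunLike.congr_fun h1 w)
  exact h2.trans (DFunLike.congr_fun h w)

theorem ofCoord_injective (hκ : κ ∈ M.charts) {x : M} (hx : x ∈ κ.source) :
    Function.Injective (M.ofCoord κ x) := fun v w h => by
  rw [← toCoord_ofCoord hκ hx v, h, toCoord_ofCoord hκ hx]

theorem ofCoord_symm_apply (hκ : κ ∈ M.charts) {y : Coord k} (hy : y ∈ κ.target) (w : Coord k) :
    M.ofCoord κ (κ.symm y) w = mfderiv 𝓘(ℝ, Coord k) 𝓘(ℝ, Coord k) κ.symm y w := by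
  have h := (mdifferentiable_of_mem_charts hκ).comp_symm_deriv hy
  have h1 := ofCoord_toCoord hκ (κ.map_target hy)
    (mfderiv 𝓘(ℝ, Coord k) 𝓘(ℝ, Coord k) κ.symm y w)
  rw [← h1]
  congr 1
  exact (DFunLike.congr_fun h w).symm

/-- A vector field whose components in a chart are smooth is smooth. -/
theorem contMDiffAt_ofCoord (hκ : κ ∈ M.charts) {y : Coord k} (hy : y ∈ κ.target)
    {c : Coord k → Coord k} (hc : ContDiffAt ℝ ∞ c y) :
    ContMDiffAt 𝓘(ℝ, Coord k) (𝓘(ℝ, Coord k).prod 𝓘(ℝ, Coord k)) ∞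
      (fun y => (⟨κ.symm y, M.ofCoord κ (κ.symm y) (c y)⟩ : TangentBundle 𝓘(ℝ, Coord k) M)) y := by
  have h1 := (contMDiffOn_symm_of_mem_maximalAtlas hκ).contMDiffOn_tangentMapWithin (m := ∞)
    (by simp) κ.open_target.uniqueMDiffOn
  have h2 : ContMDiffAt 𝓘(ℝ, Coord k) (𝓘(ℝ, Coord k).prod 𝓘(ℝ, Coord k)) ∞
      (fun y => (⟨y, c y⟩ : TangentBundle 𝓘(ℝ, Coord k) (Coord k))) y :=
    contMDiffAt_vectorSpace_iff_contDiffAt.2 hc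
  have h3 := (h1.contMDiffAt (x := ⟨y, c y⟩) ((κ.open_target.preimage
    (FiberBundle.continuous_proj _ _)).mem_nhds hy)).comp y h2
  refine h3.congr_of_eventuallyEq ?_
  filter_upwards [κ.open_target.mem_nhds hy] with z hz
  simp only [Function.comp_apply, tangentMapWithin]
  rw [mfderivWithin_of_isOpen κ.open_target hz]
  congr 1
  exact ofCoord_symm_apply hκ hz _

/-- The components of a smooth vector field in a chart are smooth. -/
theorem SmoothFieldOn.contDiffAt_toCoord (hκ : κ ∈ M.charts) {X : ∀ x : M, M.T x} {O : Set M}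
    (hX : M.SmoothFieldOn X O) (hO : IsOpen O) {x : M} (hxO : x ∈ O) (hx : x ∈ κ.source) :
    ContDiffAt ℝ ∞ (fun y => (M.toCoord κ (κ.symm y) (X (κ.symm y)) : Coord k)) (κ x) := by
  have h1 := (contMDiffOn_of_mem_maximalAtlas hκ).contMDiffOn_tangentMapWithin (m := ∞)
    (by simp) κ.open_source.uniqueMDiffOn
  have h2 := (h1.contMDiffAt (x := ⟨x, X x⟩) ((κ.open_source.preimage
    (FiberBundle.continuous_proj _ _)).mem_nhds hx)).comp x (hX.contMDiffAt (hO.mem_nhds hxO))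
  have hs := contMDiffAt_symm_of_mem_maximalAtlas hκ (κ.map_source hx)
  have h3 := (contMDiff_snd_tangentBundle_modelSpace (Coord k)
    𝓘(ℝ, Coord k)).contMDiffAt.comp x h2
  have h4 : ContMDiffAt 𝓘(ℝ, Coord k) 𝓘(ℝ, Coord k) ∞ _ (κ x) :=
    ContMDiffAt.comp (κ x) (by rw [κ.left_inv hx]; exact h3) hs
  refine h4.contDiffAt.congr_of_eventuallyEq ?_
  filter_upwards [κ.open_target.mem_nhds (κ.map_source hx)] with z hz
  exact (DFunLike.congr_fun (mfderivWithin_of_isOpen κ.open_source (κ.map_target hz)) _).symm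

end SmoothMfd

namespace LorentzMetric

variable {m : ℕ} {M : SmoothMfd.{u} (m + 2)} (g : LorentzMetric M)
  {κ : OpenPartialHomeomorph M (Coord (m + 2))}

theorem form_symm (x : M) (v w : M.T x) : g.form x v w = g.form x w v := by
  obtain ⟨b, hb⟩ := g.signature x
  have : (g.form x).toLinearMap₁₂ = (g.form x).toLinearMap₁₂.flip := by
    refine b.ext fun i => b.ext fun j => ?_
    change g.form x (b i) (b j) = g.form x (b j) (b i)
    rw [hb, hb]
    by_cases hij : i = j
    · subst hij; rfl
    · rw [if_neg hij, if_neg (Ne.symm hij)]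
  exact congrArg (fun L => L v w) this

theorem form_nondegenerate (x : M) (v : M.T x) (hv : ∀ w, g.form x v w = 0) : v = 0 := by
  obtain ⟨b, hb⟩ := g.signature x
  rw [← b.sum_repr v]
  refine Finset.sum_eq_zero fun j _ => ?_
  have h := hv (b j)
  rw [← b.sum_repr v, map_sum, sum_apply, Finset.sum_eq_single j] at h
  · rw [map_smul, smul_apply, hb, if_pos rfl, smul_eq_mul] at h
    have : b.repr v j = 0 := (mul_eq_zero.1 h).resolve_right (by split_ifs <;> norm_num)
    rw [this, zero_smul]
  · intro i _ hij
    rw [map_smul, smul_apply, hb, if_neg hij, smul_zero]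
  · simp

theorem inCoord_apply_symm (y v w : Coord (m + 2)) :
    g.inCoord κ y v w =
      g.form (κ.symm y) (M.ofCoord κ (κ.symm y) v) (M.ofCoord κ (κ.symm y) w) := rfl

theorem inCoord_apply {x : M} (hx : x ∈ κ.source) (v w : Coord (m + 2)) :
    g.inCoord κ (κ x) v w = g.form x (M.ofCoord κ x v) (M.ofCoord κ x w) := by
  rw [inCoord_apply_symm, κ.left_inv hx]

theorem contDiffAt_inCoord (hκ : κ ∈ M.charts) {y : Coord (m + 2)} (hy : y ∈ κ.target) :
    ContDiffAt ℝ ∞ (g.inCoord κ) y := by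
  suffices h : ContDiffOn ℝ ∞ (g.inCoord κ) κ.target from h.contDiffAt (κ.open_target.mem_nhds hy)
  refine contDiffOn_clm_apply.2 fun v => contDiffOn_clm_apply.2 fun w => ?_
  intro y hy
  have hb := contMDiffAt_symm_of_mem_maximalAtlas hκ hy
  have : ContMDiffAt 𝓘(ℝ, Coord (m + 2)) (𝓘(ℝ, Coord (m + 2)).prod 𝓘(ℝ, ℝ)) ∞
      (fun y => TotalSpace.mk' ℝ (E := Bundle.Trivial M ℝ) (κ.symm y)
        (g.form (κ.symm y) (M.ofCoord κ (κ.symm y) v) (M.ofCoord κ (κ.symm y) w))) y := by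
    apply ContMDiffAt.clm_bundle_apply₂ (F₁ := Coord (m + 2)) (F₂ := Coord (m + 2))
    · exact g.contMDiff.contMDiffAt.comp y hb
    · exact SmoothMfd.contMDiffAt_ofCoord hκ hy contDiffAt_const
    · exact SmoothMfd.contMDiffAt_ofCoord hκ hy contDiffAt_const
  simp only [contMDiffAt_totalSpace] at this
  exact this.2.contDiffAt.contDiffWithinAt

end LorentzMetric

/-! ### Jets in a pair of charts -/

namespace LightlikeHypersurface

variable {m : ℕ} (H : LightlikeHypersurface.{u} m)

/-- `κ` and `χ` are coordinate systems of `M` and `V` around the point `x` of `V`. -/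
structure IsChartPair (κ : H.AmbientChart) (χ : H.Chart) (x : H.V) : Prop where
  left_mem : κ ∈ H.M.charts
  right_mem : χ ∈ H.V.charts
  mem_source : x ∈ χ.source
  ι_mem_source : H.ι x ∈ κ.source

namespace IsChartPair

variable {H} {κ : H.AmbientChart} {χ : H.Chart} {x : H.V} (h : H.IsChartPair κ χ x)
include h

theorem eventually_symm :
    ∀ᶠ u in 𝓝 (χ x), u ∈ χ.target ∧ H.IsChartPair κ χ (χ.symm u) := by
  have hs : ContinuousAt χ.symm (χ x) := χ.continuousAt_symm (χ.map_source h.mem_source)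
  have hι : ContinuousAt H.ι (χ.symm (χ x)) := H.contMDiff.continuous.continuousAt
  filter_upwards [χ.open_target.mem_nhds (χ.map_source h.mem_source),
    (hι.comp hs).preimage_mem_nhds (t := κ.source) (κ.open_source.mem_nhds (by
      simpa [χ.left_inv h.mem_source] using h.ι_mem_source))] with u hu hu'
  exact ⟨hu, h.left_mem, h.right_mem, χ.map_target hu, hu'⟩

theorem ιInCoord_apply : H.ιInCoord κ χ (χ x) = κ (H.ι x) := by
  rw [ιInCoord, χ.left_inv h.mem_source]

theorem contDiffAt_ιInCoord : ContDiffAt ℝ ∞ (H.ιInCoord κ χ) (χ x) := by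
  have h1 := contMDiffAt_symm_of_mem_maximalAtlas h.right_mem (χ.map_source h.mem_source)
  have h2 : ContMDiffAt 𝓘(ℝ, Coord (m + 1)) 𝓘(ℝ, Coord (m + 2)) ∞ H.ι (χ.symm (χ x)) :=
    H.contMDiff.contMDiffAt
  have h3 : ContMDiffAt 𝓘(ℝ, Coord (m + 2)) 𝓘(ℝ, Coord (m + 2)) ∞ κ (H.ι (χ.symm (χ x))) :=
    contMDiffAt_of_mem_maximalAtlas h.left_mem (by
      rw [χ.left_inv h.mem_source]; exact h.ι_mem_source)
  exact (h3.comp (χ x) (h2.comp (χ x) h1)).contDiffAt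

theorem contDiffAt_inCoord : ContDiffAt ℝ ∞ (H.g.inCoord κ) (κ (H.ι x)) :=
  H.g.contDiffAt_inCoord h.left_mem (κ.map_source h.ι_mem_source)

theorem eventually_jet_eq (q : ℕ) :
    (fun u => H.jet q κ χ (χ.symm u)) =ᶠ[𝓝 (χ x)] fun u =>
      (fun k => iteratedFDeriv ℝ k (H.ιInCoord κ χ) u,
       fun k => iteratedFDeriv ℝ k (H.g.inCoord κ) (H.ιInCoord κ χ u)) := by
  filter_upwards [h.eventually_symm] with u hu
  rw [jet, χ.right_inv hu.1]
  rfl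

theorem contDiffAt_iteratedFDeriv_ι (k : ℕ) :
    ContDiffAt ℝ ∞ (iteratedFDeriv ℝ k (H.ιInCoord κ χ)) (χ x) :=
  h.contDiffAt_ιInCoord.iteratedFDeriv_right (mod_cast le_top)

theorem contDiffAt_iteratedFDeriv_g (k : ℕ) :
    ContDiffAt ℝ ∞ (iteratedFDeriv ℝ k (H.g.inCoord κ)) (H.ιInCoord κ χ (χ x)) := by
  rw [h.ιInCoord_apply]
  exact h.contDiffAt_inCoord.iteratedFDeriv_right (mod_cast le_top)

theorem contDiffAt_jet (q : ℕ) :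
    ContDiffAt ℝ ∞ (fun u => H.jet q κ χ (χ.symm u)) (χ x) := by
  refine ContDiffAt.congr_of_eventuallyEq ?_ (h.eventually_jet_eq q)
  refine ContDiffAt.prodMk (contDiffAt_pi.2 fun k => h.contDiffAt_iteratedFDeriv_ι k)
    (contDiffAt_pi.2 fun k => ?_)
  exact (h.contDiffAt_iteratedFDeriv_g k).comp (χ x) h.contDiffAt_ιInCoord

end IsChartPair

end LightlikeHypersurface

section Jets

variable {m : ℕ}

/-- The projection of a differential neighborhood to one of lower order. -/
def JetSpace.trunc {q q' : ℕ} (h : q ≤ q') (j : JetSpace m q') : JetSpace m q :=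
  (fun k => j.1 (Fin.castLE (by omega) k), fun k => j.2 (Fin.castLE h k))

theorem JetSpace.contDiff_trunc {q q' : ℕ} (h : q ≤ q') {n : ℕ∞ω} :
    ContDiff ℝ n (JetSpace.trunc (m := m) h) :=
  ContDiff.prodMk (contDiff_pi.2 fun _ => contDiff_pi.1 contDiff_fst _)
    (contDiff_pi.2 fun _ => contDiff_pi.1 contDiff_snd _)

/-- The first derivative of the parametric equations, as read off from a jet. -/
def JetSpace.differential {q : ℕ} (j : JetSpace m (q + 1)) :
    Coord (m + 1) →L[ℝ] Coord (m + 2) :=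
  continuousMultilinearCurryFin1 ℝ (Coord (m + 1)) (Coord (m + 2)) (j.1 ⟨1, by omega⟩)

/-- The formal derivative of jets of order `q` in the direction `w` tangent to the hypersurface, a
function of the jets of order `q + 1`. -/
def JetSpace.totalDeriv {q : ℕ} (j : JetSpace m (q + 1)) :
    Coord (m + 1) →L[ℝ] JetSpace m q :=
  (ContinuousLinearMap.pi fun k : Fin (q + 1) =>
    (continuousMultilinearCurryLeftEquiv ℝ (fun _ : Fin (k + 1) => Coord (m + 1))
      (Coord (m + 2)) (j.1 k.succ))).prod
  (ContinuousLinearMap.pi fun k : Fin q =>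
    (continuousMultilinearCurryLeftEquiv ℝ (fun _ : Fin (k + 1) => Coord (m + 2))
      (BilForm (m + 2)) (j.2 k.succ)).comp j.differential)

theorem JetSpace.contDiff_differential {q : ℕ} {n : ℕ∞ω} :
    ContDiff ℝ n (JetSpace.differential : JetSpace m (q + 1) → _) := by
  have h := LinearIsometryEquiv.contDiff (𝕜 := ℝ)
    (E := Coord (m + 1) [×1]→L[ℝ] Coord (m + 2)) (F := Coord (m + 1) →L[ℝ] Coord (m + 2)) (n := n)
    (continuousMultilinearCurryFin1 ℝ (Coord (m + 1)) (Coord (m + 2)))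
  exact h.comp (contDiff_pi.1 contDiff_fst (⟨1, by omega⟩ : Fin (q + 1 + 1)))

theorem ContDiff.curryLeft_apply {E F Z : Type*} [NormedAddCommGroup E] [NormedSpace ℝ E]
    [NormedAddCommGroup F] [NormedSpace ℝ F] [NormedAddCommGroup Z] [NormedSpace ℝ Z] {k : ℕ}
    {n : ℕ∞ω} {f : Z → E [×(k + 1)]→L[ℝ] F} {v : Z → E} (hf : ContDiff ℝ n f)
    (hv : ContDiff ℝ n v) :
    ContDiff ℝ n fun z =>
      continuousMultilinearCurryLeftEquiv ℝ (fun _ : Fin (k + 1) => E) F (f z) (v z) := by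
  have h := LinearIsometryEquiv.contDiff (𝕜 := ℝ) (E := E [×(k + 1)]→L[ℝ] F)
    (F := E →L[ℝ] E [×k]→L[ℝ] F) (n := n)
    (continuousMultilinearCurryLeftEquiv ℝ (fun _ : Fin (k + 1) => E) F)
  exact (h.comp hf).clm_apply hv

theorem JetSpace.contDiff_totalDeriv {q : ℕ} {n : ℕ∞ω} :
    ContDiff ℝ n (JetSpace.totalDeriv : JetSpace m (q + 1) → _) := by
  refine contDiff_clm_apply_iff.2 fun w => ?_
  refine ContDiff.prodMk (contDiff_pi.2 fun k => ?_) (contDiff_pi.2 fun k => ?_)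
  · exact ContDiff.curryLeft_apply (k := k) (contDiff_pi.1 contDiff_fst k.succ) contDiff_const
  · exact ContDiff.curryLeft_apply (k := k) (contDiff_pi.1 contDiff_snd k.succ)
      (JetSpace.contDiff_differential.clm_apply contDiff_const)

namespace LightlikeHypersurface.IsChartPair

variable {H : LightlikeHypersurface.{u} m} {κ : H.AmbientChart} {χ : H.Chart} {x : H.V}
  (h : H.IsChartPair κ χ x)

theorem differential_jet (q : ℕ) :
    (H.jet (q + 1) κ χ x).differential = fderiv ℝ (H.ιInCoord κ χ) (χ x) := by
  ext1 w
  exact iteratedFDeriv_one_apply _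

set_option synthInstance.maxHeartbeats 100000 in
set_option maxHeartbeats 1000000 in
include h in
theorem hasFDerivAt_jet (q : ℕ) :
    HasFDerivAt (fun u => H.jet q κ χ (χ.symm u)) (H.jet (q + 1) κ χ x).totalDeriv (χ x) := by
  refine HasFDerivAt.congr_of_eventuallyEq ?_ (h.eventually_jet_eq q)
  refine HasFDerivAt.prodMk (hasFDerivAt_pi.2 fun k => ?_) (hasFDerivAt_pi.2 fun k => ?_)
  · exact ((h.contDiffAt_iteratedFDeriv_ι k).differentiableAt (by simp)).hasFDerivAt
  · have h1 := ((h.contDiffAt_iteratedFDeriv_g k).differentiableAt (by simp)).hasFDerivAt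
    have h2 := (h.contDiffAt_ιInCoord.differentiableAt (by simp)).hasFDerivAt
    rw [differential_jet]
    have h3 := h1.comp (χ x) h2
    rw [h.ιInCoord_apply] at h3
    exact h3

end LightlikeHypersurface.IsChartPair

end Jets

/-! ### Calculus of differential orders -/

section Orders

variable {m : ℕ} {𝒞 : Set (LightlikeHypersurface.{u} m)}
  {𝒦 : ∀ M : SmoothMfd.{u} (m + 2), Set (OpenPartialHomeomorph M (Coord (m + 2)))} {q : ℕ}
  {W : Type} [NormedAddCommGroup W] [NormedSpace ℝ W]
  {W' : Type} [NormedAddCommGroup W'] [NormedSpace ℝ W']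
  {T : ∀ H : LightlikeHypersurface.{u} m, H.AmbientChart → H.Chart → H.V → W}
  {T' : ∀ H : LightlikeHypersurface.{u} m, H.AmbientChart → H.Chart → H.V → W'}

/-- The definition of the order, with the conditions on the coordinate systems gathered in
`IsChartPair`. -/
theorem hasOrder_iff : HasOrder 𝒞 𝒦 q T ↔
    ∃ (U : Set (JetSpace m q)) (F : JetSpace m q → W), IsOpen U ∧ ContDiffOn ℝ ∞ F U ∧
    ∀ H ∈ 𝒞, ∀ κ ∈ 𝒦 H.M, ∀ χ x, H.IsChartPair κ χ x →
      H.jet q κ χ x ∈ U ∧ T H κ χ x = F (H.jet q κ χ x) := by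
  refine exists_congr fun U => exists_congr fun F => and_congr_right fun _ =>
    and_congr_right fun _ => ?_
  exact ⟨fun h H hH κ hκ χ x hx => h H hH κ hκ hx.1 χ hx.2 x hx.3 hx.4,
    fun h H hH κ hκ h1 χ h2 x h3 h4 => h H hH κ hκ χ x ⟨h1, h2, h3, h4⟩⟩

theorem HasOrder.mono (hT : HasOrder 𝒞 𝒦 q T) {q' : ℕ} (hq : q ≤ q') : HasOrder 𝒞 𝒦 q' T := by
  obtain ⟨U, F, hU, hF, h⟩ := hasOrder_iff.1 hT
  have ht := JetSpace.contDiff_trunc (m := m) hq (n := ∞)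
  refine hasOrder_iff.2 ⟨JetSpace.trunc hq ⁻¹' U, F ∘ JetSpace.trunc hq,
    hU.preimage ht.continuous, hF.comp ht.contDiffOn fun _ hj => hj, ?_⟩
  exact fun H hH κ hκ χ x hx => h H hH κ hκ χ x hx

theorem HasOrder.prodMk (hT : HasOrder 𝒞 𝒦 q T) (hT' : HasOrder 𝒞 𝒦 q T') :
    HasOrder 𝒞 𝒦 q (fun H κ χ x => (T H κ χ x, T' H κ χ x)) := by
  obtain ⟨U, F, hU, hF, h⟩ := hasOrder_iff.1 hT
  obtain ⟨U', F', hU', hF', h'⟩ := hasOrder_iff.1 hT'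
  refine hasOrder_iff.2 ⟨U ∩ U', fun j => (F j, F' j), hU.inter hU',
    (hF.mono inter_subset_left).prodMk (hF'.mono inter_subset_right), ?_⟩
  intro H hH κ hκ χ x hx
  obtain ⟨h1, h2⟩ := h H hH κ hκ χ x hx
  obtain ⟨h3, h4⟩ := h' H hH κ hκ χ x hx
  exact ⟨⟨h1, h3⟩, by rw [h2, h4]⟩

/-- An object computed from objects of order `q` by a formula that is analytic at all their values
has order `q`. Analyticity, unlike smoothness, at a point persists nearby, so that the formula is
smooth on an open set of jets. -/
theorem HasOrder.comp [CompleteSpace W'] (hT : HasOrder 𝒞 𝒦 q T) (G : W → W')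
    (hG : ∀ H ∈ 𝒞, ∀ κ ∈ 𝒦 H.M, ∀ χ x, H.IsChartPair κ χ x →
      ContDiffAt ℝ ω G (T H κ χ x) ∧ T' H κ χ x = G (T H κ χ x)) : HasOrder 𝒞 𝒦 q T' := by
  obtain ⟨U, F, hU, hF, h⟩ := hasOrder_iff.1 hT
  refine hasOrder_iff.2 ⟨U ∩ F ⁻¹' {w | AnalyticAt ℝ G w}, G ∘ F,
    hF.continuousOn.isOpen_inter_preimage hU (isOpen_analyticAt ℝ G), ?_, ?_⟩
  · intro j hj
    exact (hj.2.contDiffAt.comp_contDiffWithinAt j (hF j hj.1)).mono inter_subset_left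
  · intro H hH κ hκ χ x hx
    obtain ⟨h1, h2⟩ := h H hH κ hκ χ x hx
    obtain ⟨h3, h4⟩ := hG H hH κ hκ χ x hx
    rw [h2] at h3 h4
    exact ⟨⟨h1, h3.analyticAt⟩, h4⟩

theorem HasOrder.contDiffAt (hT : HasOrder 𝒞 𝒦 q T) {H : LightlikeHypersurface.{u} m}
    (hH : H ∈ 𝒞) {κ : H.AmbientChart} (hκ : κ ∈ 𝒦 H.M) {χ : H.Chart} {x : H.V}
    (hx : H.IsChartPair κ χ x) : ContDiffAt ℝ ∞ (fun u => T H κ χ (χ.symm u)) (χ x) := by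
  obtain ⟨U, F, hU, hF, h⟩ := hasOrder_iff.1 hT
  have hF' : ContDiffAt ℝ ∞ F (H.jet q κ χ (χ.symm (χ x))) := by
    rw [χ.left_inv hx.mem_source]
    exact hF.contDiffAt (hU.mem_nhds (h H hH κ hκ χ x hx).1)
  refine (hF'.comp (χ x) (hx.contDiffAt_jet q)).congr_of_eventuallyEq ?_
  filter_upwards [hx.eventually_symm] with u hu
  exact (h H hH κ hκ χ _ hu.2).2

set_option synthInstance.maxHeartbeats 100000 in
set_option maxHeartbeats 1000000 in
/-- The derivative along the hypersurface of an object of order `q` has order `q + 1`. -/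
theorem HasOrder.derivative (hT : HasOrder 𝒞 𝒦 q T) :
    HasOrder 𝒞 𝒦 (q + 1)
      (fun H κ χ x => fderiv ℝ (fun u => T H κ χ (χ.symm u)) (χ x)) := by
  obtain ⟨U, F, hU, hF, h⟩ := hasOrder_iff.1 hT
  have ht := JetSpace.contDiff_trunc (m := m) q.le_succ (n := ∞)
  refine hasOrder_iff.2 ⟨JetSpace.trunc q.le_succ ⁻¹' U, fun j =>
    (fderiv ℝ F (JetSpace.trunc q.le_succ j)).comp j.totalDeriv,
    hU.preimage ht.continuous, ?_, ?_⟩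
  · refine ContDiffOn.clm_comp ?_ JetSpace.contDiff_totalDeriv.contDiffOn
    exact (hF.fderiv_of_isOpen hU (m := ∞) (by simp)).comp ht.contDiffOn fun _ hj => hj
  · intro H hH κ hκ χ x hx
    have h1 := (h H hH κ hκ χ x hx).1
    refine ⟨h1, ?_⟩
    have hF' : HasFDerivAt F (fderiv ℝ F (H.jet q κ χ x))
        (H.jet q κ χ (χ.symm (χ x))) := by
      rw [χ.left_inv hx.mem_source]
      exact ((hF.contDiffAt (hU.mem_nhds h1)).differentiableAt (by simp)).hasFDerivAt
    refine HasFDerivAt.fderiv ((hF'.comp (χ x) (hx.hasFDerivAt_jet q)).congr_of_eventuallyEq ?_)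
    filter_upwards [hx.eventually_symm] with u hu
    exact (h H hH κ hκ χ _ hu.2).2

theorem HasOrder.congr {S : ∀ H : LightlikeHypersurface.{u} m, H.AmbientChart → H.Chart → H.V → W}
    (hT : HasOrder 𝒞 𝒦 q T)
    (h : ∀ H ∈ 𝒞, ∀ κ χ x, H.IsChartPair κ χ x → S H κ χ x = T H κ χ x) :
    HasOrder 𝒞 𝒦 q S := by
  obtain ⟨U, F, hU, hF, hT⟩ := hasOrder_iff.1 hT
  refine hasOrder_iff.2 ⟨U, F, hU, hF, fun H hH κ hκ χ x hx => ?_⟩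
  rw [h H hH κ χ x hx]
  exact hT H hH κ hκ χ x hx

theorem hasOrder_ι : HasOrder 𝒞 𝒦 0 (fun H κ _ x => κ (H.ι x)) := by
  refine hasOrder_iff.2 ⟨univ, fun j => continuousMultilinearCurryFin0 ℝ (Coord (m + 1))
    (Coord (m + 2)) (j.1 ⟨0, by omega⟩), isOpen_univ, ContDiff.contDiffOn ?_, ?_⟩
  · have h := LinearIsometryEquiv.contDiff (𝕜 := ℝ)
      (E := Coord (m + 1) [×0]→L[ℝ] Coord (m + 2)) (F := Coord (m + 2)) (n := ∞)
      (continuousMultilinearCurryFin0 ℝ (Coord (m + 1)) (Coord (m + 2)))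
    exact h.comp (contDiff_pi.1 contDiff_fst (⟨0, by omega⟩ : Fin (0 + 1)))
  · exact fun H _ κ _ χ x hx => ⟨mem_univ _, hx.ιInCoord_apply.symm⟩

/-- The components of the metric have order 1, not 0, by the convention on `JetSpace`. -/
theorem hasOrder_inCoord : HasOrder 𝒞 𝒦 1 (fun H κ _ x => H.g.inCoord κ (κ (H.ι x))) := by
  refine hasOrder_iff.2 ⟨univ, fun j => continuousMultilinearCurryFin0 ℝ (Coord (m + 2))
    (BilForm (m + 2)) (j.2 ⟨0, by omega⟩), isOpen_univ, ContDiff.contDiffOn ?_, ?_⟩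
  · have h := LinearIsometryEquiv.contDiff (𝕜 := ℝ)
      (E := Coord (m + 2) [×0]→L[ℝ] BilForm (m + 2)) (F := BilForm (m + 2)) (n := ∞)
      (continuousMultilinearCurryFin0 ℝ (Coord (m + 2)) (BilForm (m + 2)))
    exact h.comp (contDiff_pi.1 contDiff_snd (⟨0, by omega⟩ : Fin 1))
  · exact fun H _ κ _ χ x _ => ⟨mem_univ _, rfl⟩

theorem hasOrder_fderiv_inCoord :
    HasOrder 𝒞 𝒦 2 (fun H κ _ x => fderiv ℝ (H.g.inCoord κ) (κ (H.ι x))) := by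
  refine hasOrder_iff.2 ⟨univ, fun j => continuousMultilinearCurryFin1 ℝ (Coord (m + 2))
    (BilForm (m + 2)) (j.2 ⟨1, by omega⟩), isOpen_univ, ContDiff.contDiffOn ?_, ?_⟩
  · have h := LinearIsometryEquiv.contDiff (𝕜 := ℝ)
      (E := Coord (m + 2) [×1]→L[ℝ] BilForm (m + 2))
      (F := Coord (m + 2) →L[ℝ] BilForm (m + 2)) (n := ∞)
      (continuousMultilinearCurryFin1 ℝ (Coord (m + 2)) (BilForm (m + 2)))
    exact h.comp (contDiff_pi.1 contDiff_snd (⟨1, by omega⟩ : Fin 2))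
  · refine fun H _ κ _ χ x _ => ⟨mem_univ _, ?_⟩
    ext1 w
    exact (iteratedFDeriv_one_apply (𝕜 := ℝ) (f := H.g.inCoord κ) (x := κ (H.ι x))
      (fun _ => w)).symm

end Orders

/-! ### The normalization defined by an invariant -/

namespace LightlikeHypersurface

variable {m : ℕ} {H : LightlikeHypersurface.{u} m} {J : H.V → ℝ}

theorem mdifferentiableAt_ι (x : H.V) :
    MDifferentiableAt 𝓘(ℝ, Coord (m + 1)) 𝓘(ℝ, Coord (m + 2)) H.ι x :=
  H.contMDiff.contMDiffAt.mdifferentiableAt (by simp)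

theorem mem_isotropic {x : H.V} {ξ : H.V.T x} :
    ξ ∈ H.isotropic x ↔ ∀ w, H.g.form (H.ι x) (H.dι x ξ) (H.dι x w) = 0 := Iff.rfl

theorem mem_levelDist {x : H.V} {v : H.V.T x} : v ∈ H.levelDist J x ↔ H.d J x v = 0 := Iff.rfl

/-- The linear data of the hypersurface and the invariant, on the tangent spaces themselves. These
are identified with the model spaces, which provides the norms and the auxiliary Euclidean product;
the projections are independent of them by uniqueness. -/
theorem LevelsTransversal.isLightlikeTriple (hJ : H.LevelsTransversal J) (x : H.V) :
    IsLightlikeTriple (E := Coord (m + 2)) (F := Coord (m + 1)) (H.dι x) (H.g.form (H.ι x))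
      (H.d J x) where
  finrank_eq := by simp
  injective := H.immersive x
  symm := H.g.form_symm (H.ι x)
  nondegenerate := H.g.form_nondegenerate (H.ι x)
  exists_radical := H.lightlike x
  transversal := hJ x

theorem LevelsTransversal.isScreenProjection_iff (hJ : H.LevelsTransversal J) {x : H.V}
    {P : H.V.T x →L[ℝ] H.V.T x} : H.IsScreenProjection (H.levelDist J) x P ↔
      P = screenProj (E := Coord (m + 2)) (F := Coord (m + 1)) (H.dι x) (H.g.form (H.ι x))
        (H.d J x) := by
  have t := hJ.isLightlikeTriple x
  constructor
  · exact fun h => t.screenProj_unique h.1 h.2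
  · rintro rfl
    exact ⟨fun s hs => screenProj_of_ker (E := Coord (m + 2)) (F := Coord (m + 1)) _ _ hs,
      fun ξ hξ => t.screenProj_of_radical hξ⟩

theorem LevelsTransversal.isNormalizing_nullNormal (hJ : H.LevelsTransversal J) (x : H.V) :
    H.IsNormalizing (H.levelDist J) x (nullNormal (E := Coord (m + 2)) (F := Coord (m + 1))
      (H.dι x) (H.g.form (H.ι x)) (H.d J x)) := by
  have t := hJ.isLightlikeTriple x
  refine ⟨t.nullNormal_isotropic, fun s hs => ?_, t.nullNormal_not_tangent⟩
  refine (t.nullNormal_apply s).trans ?_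
  rw [neg_eq_zero]
  exact hs

theorem LevelsTransversal.exists_smul_nullNormal (hJ : H.LevelsTransversal J) {x : H.V}
    {N : H.M.T (H.ι x)} (hN : H.IsNormalizing (H.levelDist J) x N) :
    ∃ c : ℝ, c ≠ 0 ∧ N = c • (nullNormal (E := Coord (m + 2)) (F := Coord (m + 1))
      (H.dι x) (H.g.form (H.ι x)) (H.d J x)) :=
  (hJ.isLightlikeTriple x).eq_smul_nullNormal hN.1 hN.2.1 hN.2.2

theorem LevelsTransversal.isTangentialProjection_iff (hJ : H.LevelsTransversal J) {x : H.V}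
    {Q : H.M.T (H.ι x) →L[ℝ] H.V.T x} : H.IsTangentialProjection (H.levelDist J) x Q ↔
      Q = tangentProj (E := Coord (m + 2)) (F := Coord (m + 1)) (H.dι x) (H.g.form (H.ι x))
        (H.d J x) := by
  have t := hJ.isLightlikeTriple x
  constructor
  · exact fun h => t.tangentProj_unique h.1 (h.2 _ (hJ.isNormalizing_nullNormal x))
  · rintro rfl
    refine ⟨fun v => t.tangentProj_of_tangent v, fun N hN => ?_⟩
    obtain ⟨c, _, rfl⟩ := hJ.exists_smul_nullNormal hN
    exact (map_smul _ c _).trans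
      ((congrArg (c • ·) t.tangentProj_nullNormal).trans (smul_zero c))

theorem LevelsTransversal.isScreenProjection_screenProjection (hJ : H.LevelsTransversal J)
    (x : H.V) :
    H.IsScreenProjection (H.levelDist J) x (H.screenProjection (H.levelDist J) x) := by
  have h : ∃ P, H.IsScreenProjection (H.levelDist J) x P := ⟨_, hJ.isScreenProjection_iff.2 rfl⟩
  rw [screenProjection, dif_pos h]
  exact h.choose_spec

theorem LevelsTransversal.isTangentialProjection_tangentialProjection
    (hJ : H.LevelsTransversal J) (x : H.V) : H.IsTangentialProjection (H.levelDist J) x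
      (H.tangentialProjection (H.levelDist J) x) := by
  have h : ∃ Q, H.IsTangentialProjection (H.levelDist J) x Q :=
    ⟨_, hJ.isTangentialProjection_iff.2 rfl⟩
  rw [tangentialProjection, dif_pos h]
  exact h.choose_spec

/-! ### The normalization in coordinates -/

namespace IsChartPair

variable {κ : H.AmbientChart} {χ : H.Chart} {x : H.V} (h : H.IsChartPair κ χ x)
include h

theorem fderiv_comp_symm {J : H.V → ℝ} (hJ : ContMDiff 𝓘(ℝ, Coord (m + 1)) 𝓘(ℝ, ℝ) ∞ J)
    (w : Coord (m + 1)) :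
    fderiv ℝ (fun u => J (χ.symm u)) (χ x) w = H.d J x (H.V.ofCoord χ x w) := by
  have hu := χ.map_source h.mem_source
  have h1 : MDifferentiableAt 𝓘(ℝ, Coord (m + 1)) 𝓘(ℝ, Coord (m + 1)) χ.symm (χ x) :=
    (contMDiffAt_symm_of_mem_maximalAtlas h.right_mem hu).mdifferentiableAt (by simp)
  have h2 : MDifferentiableAt 𝓘(ℝ, Coord (m + 1)) 𝓘(ℝ, ℝ) J (χ.symm (χ x)) :=
    hJ.contMDiffAt.mdifferentiableAt (by simp)
  have h3 : fderiv ℝ (fun u => J (χ.symm u)) (χ x) w =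
      H.d J (χ.symm (χ x)) (H.V.ofCoord χ (χ.symm (χ x)) w) := by
    rw [SmoothMfd.ofCoord_symm_apply h.right_mem hu, ← mfderiv_eq_fderiv]
    exact DFunLike.congr_fun (mfderiv_comp (χ x) h2 h1) w
  rw [χ.left_inv h.mem_source] at h3
  exact h3

theorem fderiv_ιInCoord (w : Coord (m + 1)) :
    fderiv ℝ (H.ιInCoord κ χ) (χ x) w =
      H.M.toCoord κ (H.ι x) (H.dι x (H.V.ofCoord χ x w)) := by
  have hu := χ.map_source h.mem_source
  have h1 : MDifferentiableAt 𝓘(ℝ, Coord (m + 1)) 𝓘(ℝ, Coord (m + 1)) χ.symm (χ x) :=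
    (contMDiffAt_symm_of_mem_maximalAtlas h.right_mem hu).mdifferentiableAt (by simp)
  have h2 := H.mdifferentiableAt_ι (χ.symm (χ x))
  have h3 : MDifferentiableAt 𝓘(ℝ, Coord (m + 2)) 𝓘(ℝ, Coord (m + 2)) κ (H.ι (χ.symm (χ x))) :=
    (contMDiffAt_of_mem_maximalAtlas h.left_mem (by
      rw [χ.left_inv h.mem_source]; exact h.ι_mem_source)).mdifferentiableAt (by simp)
  have h4 : fderiv ℝ (H.ιInCoord κ χ) (χ x) w =
      H.M.toCoord κ (H.ι (χ.symm (χ x))) (H.dι (χ.symm (χ x))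
        (H.V.ofCoord χ (χ.symm (χ x)) w)) := by
    rw [SmoothMfd.ofCoord_symm_apply h.right_mem hu, ← mfderiv_eq_fderiv]
    have h5 := mfderiv_comp (χ x) h3 (h2.comp (χ x) h1)
    have h6 := mfderiv_comp (χ x) h2 h1
    exact (DFunLike.congr_fun h5 w).trans (congrArg (H.M.toCoord κ (H.ι (χ.symm (χ x))))
      (DFunLike.congr_fun h6 w))
  rw [χ.left_inv h.mem_source] at h4
  exact h4

theorem ofCoord_fderiv_ιInCoord (w : Coord (m + 1)) :
    H.M.ofCoord κ (H.ι x) (fderiv ℝ (H.ιInCoord κ χ) (χ x) w) =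
      H.dι x (H.V.ofCoord χ x w) := by
  rw [h.fderiv_ιInCoord, SmoothMfd.ofCoord_toCoord h.left_mem h.ι_mem_source]

theorem inCoord_fderiv (X : Coord (m + 2)) (w : Coord (m + 1)) :
    H.g.inCoord κ (κ (H.ι x)) X (fderiv ℝ (H.ιInCoord κ χ) (χ x) w) =
      H.g.form (H.ι x) (H.M.ofCoord κ (H.ι x) X) (H.dι x (H.V.ofCoord χ x w)) := by
  rw [H.g.inCoord_apply h.ι_mem_source, h.ofCoord_fderiv_ιInCoord]

/-- The radical in coordinates represents the isotropic direction. -/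
theorem radical_iff {ξ : Coord (m + 1)} :
    (∀ w, H.g.inCoord κ (κ (H.ι x)) (fderiv ℝ (H.ιInCoord κ χ) (χ x) ξ)
      (fderiv ℝ (H.ιInCoord κ χ) (χ x) w) = 0) ↔ H.V.ofCoord χ x ξ ∈ H.isotropic x := by
  simp only [mem_isotropic, h.inCoord_fderiv, h.ofCoord_fderiv_ιInCoord]
  refine ⟨fun h1 w => ?_, fun h1 w => h1 _⟩
  rw [← SmoothMfd.ofCoord_toCoord h.right_mem h.mem_source w]
  exact h1 _

/-- The linear data of the hypersurface and the invariant, in coordinates. -/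
theorem isLightlikeTriple (hJ : ContMDiff 𝓘(ℝ, Coord (m + 1)) 𝓘(ℝ, ℝ) ∞ J)
    (hJt : H.LevelsTransversal J) :
    IsLightlikeTriple (fderiv ℝ (H.ιInCoord κ χ) (χ x)) (H.g.inCoord κ (κ (H.ι x)))
      (fderiv ℝ (fun u => J (χ.symm u)) (χ x)) where
  finrank_eq := by simp
  injective := fun v w hvw => by
    refine SmoothMfd.ofCoord_injective h.right_mem h.mem_source (H.immersive x ?_)
    exact (h.ofCoord_fderiv_ιInCoord v).symm.trans
      ((congrArg _ hvw).trans (h.ofCoord_fderiv_ιInCoord w))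
  symm := fun v w => by
    rw [H.g.inCoord_apply h.ι_mem_source, H.g.inCoord_apply h.ι_mem_source, H.g.form_symm]
  nondegenerate := fun u hu => by
    refine SmoothMfd.ofCoord_injective h.left_mem h.ι_mem_source ?_
    rw [map_zero]
    refine H.g.form_nondegenerate _ _ fun w => ?_
    rw [← SmoothMfd.ofCoord_toCoord h.left_mem h.ι_mem_source w,
      ← H.g.inCoord_apply h.ι_mem_source]
    exact hu _
  exists_radical := by
    obtain ⟨ξ, hξ0, hξ⟩ := H.lightlike x
    refine ⟨H.V.toCoord χ x ξ, fun h0 => hξ0 ?_, h.radical_iff.2 ?_⟩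
    · rw [← SmoothMfd.ofCoord_toCoord h.right_mem h.mem_source ξ, h0, map_zero]
    · rw [SmoothMfd.ofCoord_toCoord h.right_mem h.mem_source]
      exact hξ
  transversal := fun ξ hξ hξ0 => by
    rw [h.fderiv_comp_symm hJ]
    refine hJt x _ (h.radical_iff.1 hξ) fun h0 => hξ0 ?_
    exact SmoothMfd.ofCoord_injective h.right_mem h.mem_source (h0.trans (map_zero _).symm)

/-- The coordinate matrix of the intrinsic screen projection is the one computed from the linear
data in coordinates. -/
theorem screenProjectionInCoord_eq (hJ : ContMDiff 𝓘(ℝ, Coord (m + 1)) 𝓘(ℝ, ℝ) ∞ J)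
    (hJt : H.LevelsTransversal J) :
    H.screenProjectionInCoord (H.levelDist J) χ x =
      screenProj (fderiv ℝ (H.ιInCoord κ χ) (χ x)) (H.g.inCoord κ (κ (H.ι x)))
        (fderiv ℝ (fun u => J (χ.symm u)) (χ x)) := by
  have hP := hJt.isScreenProjection_screenProjection x
  refine (h.isLightlikeTriple hJ hJt).screenProj_unique (fun s hs => ?_) (fun η hη => ?_)
  · rw [h.fderiv_comp_symm hJ] at hs
    have h1 := hP.1 _ (mem_levelDist.2 hs)
    exact (congrArg (H.V.toCoord χ x) h1).trans
      (SmoothMfd.toCoord_ofCoord h.right_mem h.mem_source s)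
  · have h1 := hP.2 _ (h.radical_iff.1 hη)
    exact (congrArg (H.V.toCoord χ x) h1).trans (map_zero _)

theorem isNormalizing_ofCoord_nullNormal
    (hJ : ContMDiff 𝓘(ℝ, Coord (m + 1)) 𝓘(ℝ, ℝ) ∞ J) (hJt : H.LevelsTransversal J) :
    H.IsNormalizing (H.levelDist J) x (H.M.ofCoord κ (H.ι x)
      (nullNormal (fderiv ℝ (H.ιInCoord κ χ) (χ x)) (H.g.inCoord κ (κ (H.ι x)))
        (fderiv ℝ (fun u => J (χ.symm u)) (χ x)))) := by
  have t := h.isLightlikeTriple hJ hJt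
  refine ⟨?_, fun s hs => ?_, fun v hv => ?_⟩
  · have h1 := t.nullNormal_isotropic
    rw [H.g.inCoord_apply h.ι_mem_source] at h1
    exact h1
  · have h1 := t.nullNormal_apply (H.V.toCoord χ x s)
    rw [h.inCoord_fderiv, h.fderiv_comp_symm hJ,
      SmoothMfd.ofCoord_toCoord h.right_mem h.mem_source, mem_levelDist.1 hs, neg_zero] at h1
    exact h1
  · refine t.nullNormal_not_tangent (H.V.toCoord χ x v) ?_
    rw [h.fderiv_ιInCoord, SmoothMfd.ofCoord_toCoord h.right_mem h.mem_source, hv,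
      SmoothMfd.toCoord_ofCoord h.left_mem h.ι_mem_source]

theorem tangentialProjectionInCoord_eq (hJ : ContMDiff 𝓘(ℝ, Coord (m + 1)) 𝓘(ℝ, ℝ) ∞ J)
    (hJt : H.LevelsTransversal J) :
    H.tangentialProjectionInCoord (H.levelDist J) κ χ x =
      tangentProj (fderiv ℝ (H.ιInCoord κ χ) (χ x)) (H.g.inCoord κ (κ (H.ι x)))
        (fderiv ℝ (fun u => J (χ.symm u)) (χ x)) := by
  have hQ := hJt.isTangentialProjection_tangentialProjection x
  refine (h.isLightlikeTriple hJ hJt).tangentProj_unique (fun v => ?_) ?_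
  · have h1 := hQ.1 (H.V.ofCoord χ x v)
    rw [← h.ofCoord_fderiv_ιInCoord] at h1
    exact (congrArg (H.V.toCoord χ x) h1).trans
      (SmoothMfd.toCoord_ofCoord h.right_mem h.mem_source v)
  · have h1 := hQ.2 _ (h.isNormalizing_ofCoord_nullNormal hJ hJt)
    exact (congrArg (H.V.toCoord χ x) h1).trans (map_zero _)

end IsChartPair

end LightlikeHypersurface

/-! ### The Christoffel map -/

section Christoffel

variable {E : Type} [NormedAddCommGroup E] [NormedSpace ℝ E]

/-- The Christoffel map as a function of the value `B` and the first derivative `D` of the metric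
in coordinates. -/
def christoffelForm (B : E →L[ℝ] E →L[ℝ] ℝ) (D : E →L[ℝ] E →L[ℝ] E →L[ℝ] ℝ) (v w : E) : E :=
  B.inverse ((1 / 2 : ℝ) • (D v w + D w v - (D.flip v).flip w))

theorem christoffel_eq (g : E → E →L[ℝ] E →L[ℝ] ℝ) (y v w : E) :
    christoffel g y v w = christoffelForm (g y) (fderiv ℝ g y) v w := rfl

theorem christoffel_add_left (g : E → E →L[ℝ] E →L[ℝ] ℝ) (y v v' w : E) :
    christoffel g y (v + v') w = christoffel g y v w + christoffel g y v' w := by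
  have h : ∀ D : E →L[ℝ] E →L[ℝ] E →L[ℝ] ℝ,
      D (v + v') w + D w (v + v') - (D.flip (v + v')).flip w =
        (D v w + D w v - (D.flip v).flip w) + (D v' w + D w v' - (D.flip v').flip w) := by
    intro D
    ext z
    simp only [map_add, add_apply, sub_apply, ContinuousLinearMap.flip_apply]
    ring
  rw [christoffel, h, smul_add, map_add, christoffel, christoffel]

theorem christoffel_smul_left (g : E → E →L[ℝ] E →L[ℝ] ℝ) (y v w : E) (c : ℝ) :
    christoffel g y (c • v) w = c • christoffel g y v w := by
  have h : ∀ D : E →L[ℝ] E →L[ℝ] E →L[ℝ] ℝ,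
      D (c • v) w + D w (c • v) - (D.flip (c • v)).flip w =
        c • (D v w + D w v - (D.flip v).flip w) := by
    intro D
    ext z
    simp only [map_smul, smul_apply, add_apply, sub_apply, ContinuousLinearMap.flip_apply,
      smul_eq_mul]
    ring
  rw [christoffel, h, smul_comm, map_smul, christoffel]

/-- The Levi-Civita connection is torsion-free. -/
theorem christoffel_comm {g : E → E →L[ℝ] E →L[ℝ] ℝ} (hg : ∀ y v w, g y v w = g y w v) {y : E}
    (hd : DifferentiableAt ℝ g y) (v w : E) : christoffel g y v w = christoffel g y w v := by
  have hD : ∀ z v w, fderiv ℝ g y z v w = fderiv ℝ g y z w v := by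
    have h1 : ∀ v w, HasFDerivAt (fun y => g y v w)
        (((fderiv ℝ g y).flip v).flip w) y := by
      intro v w
      have h2 := (hd.hasFDerivAt.clm_apply (hasFDerivAt_const v y)).clm_apply
        (hasFDerivAt_const w y)
      refine h2.congr_fderiv ?_
      ext z
      simp
    intro z v w
    have h3 := (h1 v w).unique (by simpa only [hg _ w v] using h1 w v)
    exact DFunLike.congr_fun h3 z
  have h : fderiv ℝ g y v w + fderiv ℝ g y w v - ((fderiv ℝ g y).flip v).flip w =
      fderiv ℝ g y w v + fderiv ℝ g y v w - ((fderiv ℝ g y).flip w).flip v := by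
    ext z
    simp only [add_apply, sub_apply, ContinuousLinearMap.flip_apply, hD z v w]
    ring
  rw [christoffel, h, christoffel]

theorem ContDiffAt.christoffelForm [CompleteSpace E] {Z : Type*} [NormedAddCommGroup Z]
    [NormedSpace ℝ Z] {n : ℕ∞ω} {z : Z} {B : Z → E →L[ℝ] E →L[ℝ] ℝ}
    {D : Z → E →L[ℝ] E →L[ℝ] E →L[ℝ] ℝ} {v w : Z → E} (hB : ContDiffAt ℝ n B z)
    (hD : ContDiffAt ℝ n D z) (hv : ContDiffAt ℝ n v z) (hw : ContDiffAt ℝ n w z)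
    (hi : (B z).IsInvertible) :
    ContDiffAt ℝ n (fun z => _root_.christoffelForm (B z) (D z) (v z) (w z)) z := by
  refine ContDiffAt.clm_inverse_apply hB (ContDiffAt.const_smul _ ?_) hi
  exact (((hD.clm_apply hv).clm_apply hw).add ((hD.clm_apply hw).clm_apply hv)).sub
    (((ContDiffAt.clm_flip (U := E) (V := E) (W := E →L[ℝ] ℝ) hD).clm_apply hv).clm_flip.clm_apply
      hw)

end Christoffel

/-! ### The Levi-Civita connection along the hypersurface and the induced connection -/

section Connection

variable {m : ℕ}

/-- The values, at a point and in coordinates, on which the induced connection depends: the first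
derivatives of the parametric equations, the metric, the differential of the invariant, the second
derivatives of the parametric equations, and the first derivatives of the metric. -/
abbrev ConnectionData (m : ℕ) : Type :=
  (Coord (m + 1) →L[ℝ] Coord (m + 2)) × BilForm (m + 2) × (Coord (m + 1) →L[ℝ] ℝ) ×
    (Coord (m + 1) →L[ℝ] Coord (m + 1) →L[ℝ] Coord (m + 2)) × (Coord (m + 2) →L[ℝ] BilForm (m + 2))

/-- The components of the Levi-Civita derivative in the direction `v` of a tangent vector field of
the hypersurface that has the value `y` and the derivative `b` in the direction `v`. -/
def ConnectionData.leviCivita (d : ConnectionData m) (v y b : Coord (m + 1)) : Coord (m + 2) :=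
  d.2.2.2.1 v y + d.1 b + christoffelForm d.2.1 d.2.2.2.2 (d.1 v) (d.1 y)

/-- The components of the induced covariant derivative in the direction `v` of a vector field that
has the value `y` and the derivative `b` in the direction `v`. -/
def ConnectionData.induced (d : ConnectionData m) (v y b : Coord (m + 1)) : Coord (m + 1) :=
  tangentProj d.1 d.2.1 d.2.2.1 (d.leviCivita v y b)

theorem ContDiffAt.connectionData_induced {Z : Type*} [NormedAddCommGroup Z] [NormedSpace ℝ Z]
    {n : ℕ∞ω} {z : Z} {d : Z → ConnectionData m} {v y b : Z → Coord (m + 1)}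
    (hd : ContDiffAt ℝ n d z) (hv : ContDiffAt ℝ n v z) (hy : ContDiffAt ℝ n y z)
    (hb : ContDiffAt ℝ n b z) (ht : IsLightlikeTriple (d z).1 (d z).2.1 (d z).2.2.1) :
    ContDiffAt ℝ n (fun z => (d z).induced (v z) (y z) (b z)) z := by
  have h1 := hd.fst
  have h2 := hd.snd.fst
  have h3 := hd.snd.snd.fst
  have h4 := hd.snd.snd.snd.fst
  have h5 := hd.snd.snd.snd.snd
  refine (h1.tangentProj h2 h3 ht).clm_apply ?_
  exact (((h4.clm_apply hv).clm_apply hy).add (h1.clm_apply hb)).add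
    (h2.christoffelForm h5 (h1.clm_apply hv) (h1.clm_apply hy) ht.isInvertible_form)

namespace LightlikeHypersurface

/-- The connection data of a hypersurface with an invariant `J`. -/
def connectionData (H : LightlikeHypersurface.{u} m) (J : H.V → ℝ) (κ : H.AmbientChart)
    (χ : H.Chart) (x : H.V) : ConnectionData m :=
  (fderiv ℝ (H.ιInCoord κ χ) (χ x), H.g.inCoord κ (κ (H.ι x)),
    fderiv ℝ (fun u => J (χ.symm u)) (χ x), fderiv ℝ (fderiv ℝ (H.ιInCoord κ χ)) (χ x),
    fderiv ℝ (H.g.inCoord κ) (κ (H.ι x)))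

variable {H : LightlikeHypersurface.{u} m} {J : H.V → ℝ} {κ : H.AmbientChart} {χ : H.Chart}
  {x : H.V}

/-- The components, in a coordinate system `χ`, of a vector field on the hypersurface. -/
def fieldInCoord (χ : H.Chart) (Y : ∀ x : H.V, H.V.T x) (u : Coord (m + 1)) : Coord (m + 1) :=
  H.V.toCoord χ (χ.symm u) (Y (χ.symm u))

namespace IsChartPair

theorem fieldInCoord_apply (h : H.IsChartPair κ χ x) (Y : ∀ x : H.V, H.V.T x) :
    fieldInCoord χ Y (χ x) = H.V.toCoord χ x (Y x) := by
  rw [fieldInCoord, χ.left_inv h.mem_source]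

/-- The Levi-Civita derivative of a tangent field of the hypersurface depends only on the connection
data and on the 1-jet of the field. -/
theorem leviCivita_ofCoord (h : H.IsChartPair κ χ x) (J : H.V → ℝ) {Y : ∀ x : H.V, H.V.T x}
    (hY : DifferentiableAt ℝ (fieldInCoord χ Y) (χ x)) (v : Coord (m + 1)) :
    H.leviCivita κ χ (fun x' => H.dι x' (Y x')) x (H.V.ofCoord χ x v) =
      H.M.ofCoord κ (H.ι x) ((H.connectionData J κ χ x).leviCivita v (H.V.toCoord χ x (Y x))
        (fderiv ℝ (fieldInCoord χ Y) (χ x) v)) := by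
  have h1 : (fun u => (H.M.toCoord κ (H.ι (χ.symm u)) (H.dι (χ.symm u) (Y (χ.symm u))) :
      Coord (m + 2))) =ᶠ[𝓝 (χ x)] fun u => fderiv ℝ (H.ιInCoord κ χ) u (fieldInCoord χ Y u) := by
    filter_upwards [h.eventually_symm] with u hu
    have h2 := hu.2.fderiv_ιInCoord (fieldInCoord χ Y u)
    rw [χ.right_inv hu.1] at h2
    rw [h2, fieldInCoord, SmoothMfd.ofCoord_toCoord hu.2.right_mem hu.2.mem_source]
  have h3 : DifferentiableAt ℝ (fderiv ℝ (H.ιInCoord κ χ)) (χ x) :=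
    (h.contDiffAt_ιInCoord.fderiv_right (m := 1) (by norm_cast)).differentiableAt (by simp)
  have h4 := (h3.hasFDerivAt.clm_apply hY.hasFDerivAt).congr_of_eventuallyEq h1
  rw [leviCivita, h4.fderiv, SmoothMfd.toCoord_ofCoord h.right_mem h.mem_source,
    ← h.fderiv_ιInCoord, ConnectionData.leviCivita, christoffel_eq, h.fieldInCoord_apply]
  have h5 := h.fderiv_ιInCoord (H.V.toCoord χ x (Y x))
  rw [SmoothMfd.ofCoord_toCoord h.right_mem h.mem_source] at h5
  rw [← h5]
  congr 2
  exact add_comm _ _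

theorem toCoord_inducedConnection (h : H.IsChartPair κ χ x)
    (hJ : ContMDiff 𝓘(ℝ, Coord (m + 1)) 𝓘(ℝ, ℝ) ∞ J) (hJt : H.LevelsTransversal J)
    {Y : ∀ x : H.V, H.V.T x} (hY : DifferentiableAt ℝ (fieldInCoord χ Y) (χ x))
    (v : Coord (m + 1)) :
    H.V.toCoord χ x (H.inducedConnection (H.levelDist J) κ χ Y x (H.V.ofCoord χ x v)) =
      (H.connectionData J κ χ x).induced v (H.V.toCoord χ x (Y x))
        (fderiv ℝ (fieldInCoord χ Y) (χ x) v) := by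
  rw [inducedConnection, h.leviCivita_ofCoord J hY]
  exact DFunLike.congr_fun (h.tangentialProjectionInCoord_eq hJ hJt) _

theorem eventuallyEq_fieldInCoord_coordField (h : H.IsChartPair κ χ x) (z : Coord (m + 1)) :
    fieldInCoord χ (H.coordField χ z) =ᶠ[𝓝 (χ x)] fun _ => z := by
  filter_upwards [h.eventually_symm] with u hu
  exact SmoothMfd.toCoord_ofCoord hu.2.right_mem hu.2.mem_source z

/-- The components of the induced derivatives of the coordinate vector fields. -/
theorem toCoord_inducedConnection_coordField (h : H.IsChartPair κ χ x)
    (hJ : ContMDiff 𝓘(ℝ, Coord (m + 1)) 𝓘(ℝ, ℝ) ∞ J) (hJt : H.LevelsTransversal J)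
    (w z : Coord (m + 1)) :
    H.V.toCoord χ x (H.inducedConnection (H.levelDist J) κ χ (H.coordField χ z) x
        (H.coordField χ w x)) =
      (H.connectionData J κ χ x).induced w z 0 := by
  have h1 := h.eventuallyEq_fieldInCoord_coordField z
  have h2 := (hasFDerivAt_const (𝕜 := ℝ) z (χ x)).congr_of_eventuallyEq h1
  have h3 := h.toCoord_inducedConnection hJ hJt h2.differentiableAt w
  rw [h2.fderiv, coordField, SmoothMfd.toCoord_ofCoord h.right_mem h.mem_source] at h3
  exact h3

end IsChartPair

end LightlikeHypersurface

end Connection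

/-! ### Orders of the normalization and of the induced curvature -/

section Orders

variable {m : ℕ} {𝒞 : Set (LightlikeHypersurface.{u} m)}
  {𝒦 : ∀ M : SmoothMfd.{u} (m + 2), Set (OpenPartialHomeomorph M (Coord (m + 2)))} {p : ℕ}
  {J : AbsoluteInvariant.{u} m}

/-- The first derivatives of the parametric equations, the metric and the differential of an
invariant of order `p` have together the order `p + 1`. -/
theorem hasOrder_lightlikeTriple (hJp : HasOrder 𝒞 𝒦 p (fun H _ _ x => J H x)) :
    HasOrder 𝒞 𝒦 (p + 1) (fun H κ χ x => (fderiv ℝ (H.ιInCoord κ χ) (χ x),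
      H.g.inCoord κ (κ (H.ι x)), fderiv ℝ (fun u => J H (χ.symm u)) (χ x))) :=
  (hasOrder_ι.derivative.mono (by omega)).prodMk
    ((hasOrder_inCoord.mono (by omega)).prodMk hJp.derivative)

theorem hasOrder_connectionData (hp : 1 ≤ p) (hJp : HasOrder 𝒞 𝒦 p (fun H _ _ x => J H x)) :
    HasOrder 𝒞 𝒦 (p + 1) (fun H κ χ x => H.connectionData (J H) κ χ x) := by
  have h1 : HasOrder 𝒞 𝒦 2 (fun H κ χ x => fderiv ℝ (fderiv ℝ (H.ιInCoord κ χ))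
      (χ x)) := by
    refine hasOrder_ι.derivative.derivative.congr fun H _ κ χ x hx => ?_
    refine Filter.EventuallyEq.fderiv_eq ?_
    filter_upwards [hx.eventually_symm] with u hu
    rw [χ.right_inv hu.1]
    rfl
  exact (hasOrder_ι.derivative.mono (by omega)).prodMk ((hasOrder_inCoord.mono (by omega)).prodMk
    (hJp.derivative.prodMk ((h1.mono (by omega)).prodMk (hasOrder_fderiv_inCoord.mono (by omega)))))

variable (hJ : ∀ H ∈ 𝒞, ContMDiff 𝓘(ℝ, Coord (m + 1)) 𝓘(ℝ, ℝ) ∞ (J H))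
  (htrans : ∀ H ∈ 𝒞, H.LevelsTransversal (J H))
include hJ htrans

theorem hasOrder_screenProjection (hJp : HasOrder 𝒞 𝒦 p (fun H _ _ x => J H x)) :
    HasOrder 𝒞 𝒦 (p + 1)
      (fun H _ χ x => H.screenProjectionInCoord (H.levelDist (J H)) χ x) := by
  refine (hasOrder_lightlikeTriple hJp).comp (fun d => screenProj d.1 d.2.1 d.2.2)
    fun H hH κ hκ χ x hx => ⟨?_, hx.screenProjectionInCoord_eq (hJ H hH) (htrans H hH)⟩
  exact contDiffAt_fst.screenProj contDiffAt_snd.fst contDiffAt_snd.snd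
    (hx.isLightlikeTriple (hJ H hH) (htrans H hH))

theorem hasOrder_tangentialProjection (hJp : HasOrder 𝒞 𝒦 p (fun H _ _ x => J H x)) :
    HasOrder 𝒞 𝒦 (p + 1)
      (fun H κ χ x => H.tangentialProjectionInCoord (H.levelDist (J H)) κ χ x) := by
  refine (hasOrder_lightlikeTriple hJp).comp (fun d => tangentProj d.1 d.2.1 d.2.2)
    fun H hH κ hκ χ x hx => ⟨?_, hx.tangentialProjectionInCoord_eq (hJ H hH) (htrans H hH)⟩
  exact contDiffAt_fst.tangentProj contDiffAt_snd.fst contDiffAt_snd.snd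
    (hx.isLightlikeTriple (hJ H hH) (htrans H hH))

/-- The Christoffel symbols of the induced connection have order `p + 1`: they involve the first
derivatives of the metric and the second derivatives of the parametric equations, whence `1 ≤ p`. -/
theorem hasOrder_inducedConnection (hp : 1 ≤ p)
    (hJp : HasOrder 𝒞 𝒦 p (fun H _ _ x => J H x)) (w z : Coord (m + 1)) :
    HasOrder 𝒞 𝒦 (p + 1) (fun H κ χ x => (H.V.toCoord χ x (H.inducedConnection
      (H.levelDist (J H)) κ χ (H.coordField χ z) x (H.coordField χ w x)) : Coord (m + 1))) := by
  refine (hasOrder_connectionData hp hJp).comp (fun d => d.induced w z 0) fun H hH κ hκ χ x hx =>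
    ⟨?_, hx.toCoord_inducedConnection_coordField (hJ H hH) (htrans H hH) w z⟩
  exact contDiffAt_id.connectionData_induced contDiffAt_const contDiffAt_const contDiffAt_const
    (hx.isLightlikeTriple (hJ H hH) (htrans H hH))

set_option maxHeartbeats 1000000 in
/-- The curvature is computed from the connection data, the components of `∇_w z` and `∇_v z`, and
their first derivatives; only the latter raise the order to `p + 2`. -/
theorem hasOrder_inducedCurvature (hp : 1 ≤ p)
    (hJp : HasOrder 𝒞 𝒦 p (fun H _ _ x => J H x)) (v w z : Coord (m + 1)) :
    HasOrder 𝒞 𝒦 (p + 2)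
      (fun H κ χ x => H.inducedCurvature (H.levelDist (J H)) κ χ v w z x) := by
  have hw := hasOrder_inducedConnection hJ htrans hp hJp w z
  have hv := hasOrder_inducedConnection hJ htrans hp hJp v z
  refine (((hasOrder_connectionData hp hJp).mono (p + 1).le_succ).prodMk
    (((hw.mono (p + 1).le_succ).prodMk hw.derivative).prodMk
      ((hv.mono (p + 1).le_succ).prodMk hv.derivative))).comp
    (fun d => d.1.induced v d.2.1.1 (d.2.1.2 v) - d.1.induced w d.2.2.1 (d.2.2.2 w))
    fun H hH κ hκ χ x hx => ⟨?_, ?_⟩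
  · have ht := hx.isLightlikeTriple (hJ H hH) (htrans H hH)
    exact (contDiffAt_fst.connectionData_induced contDiffAt_const contDiffAt_snd.fst.fst
      (contDiffAt_snd.fst.snd.clm_apply contDiffAt_const) ht).sub
      (contDiffAt_fst.connectionData_induced contDiffAt_const contDiffAt_snd.snd.fst
      (contDiffAt_snd.snd.snd.clm_apply contDiffAt_const) ht)
  · -- the inner derivatives are smooth fields, so that the outer ones are not junk values
    have hY : ∀ z' w', DifferentiableAt ℝ (LightlikeHypersurface.fieldInCoord χ fun x' =>
        H.inducedConnection (H.levelDist (J H)) κ χ (H.coordField χ z') x'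
          (H.coordField χ w' x')) (χ x) :=
      fun z' w' => ((hasOrder_inducedConnection hJ htrans hp hJp w' z').contDiffAt hH hκ
        hx).differentiableAt (by simp)
    rw [LightlikeHypersurface.inducedCurvature]
    have h1 := hx.toCoord_inducedConnection (hJ H hH) (htrans H hH) (hY z w) v
    have h2 := hx.toCoord_inducedConnection (hJ H hH) (htrans H hH) (hY z v) w
    exact (map_sub _ _ _).trans (congrArg₂ (· - ·) h1 h2)

end Orders

/-! ### Bases of the kernel of a covector -/

section Kernel

variable {V : Type*} [AddCommGroup V] [Module ℝ V] {m : ℕ} {ξ : V} {w : Fin m → V}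

theorem linearIndependent_add_smul
    (hw : LinearIndependent ℝ (Fin.cons ξ w : Fin (m + 1) → V)) (c : Fin m → ℝ) :
    LinearIndependent ℝ fun a => w a + c a • ξ := by
  refine Fintype.linearIndependent_iff.2 fun g hg a => ?_
  have h := Fintype.linearIndependent_iff.1 hw (Fin.cons (∑ b, g b * c b) g) (by
    rw [← hg, Fin.sum_univ_succ]
    simp [smul_smul, Finset.sum_add_distrib, Finset.sum_smul, add_comm]) a.succ
  simpa using h

/-- The vectors of a basis `ξ, w_a`, corrected along `ξ` so that `l` vanishes on them, span the
kernel of `l`. -/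
theorem span_add_smul_eq_ker [FiniteDimensional ℝ V] (hV : Module.finrank ℝ V = m + 1)
    (hw : LinearIndependent ℝ (Fin.cons ξ w : Fin (m + 1) → V)) {l : V →ₗ[ℝ] ℝ} (hl : l ξ ≠ 0) :
    Submodule.span ℝ (range fun a => w a + (-(l (w a)) / l ξ) • ξ) = LinearMap.ker l := by
  refine Submodule.eq_of_le_of_finrank_eq (Submodule.span_le.2 ?_) ?_
  · rintro _ ⟨a, rfl⟩
    simp [div_mul_cancel₀ _ hl]
  · have h0 : l ≠ 0 := fun h0 => hl (by simp [h0])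
    have h1 := Module.Dual.finrank_ker_add_one_of_ne_zero h0
    rw [finrank_span_eq_card (linearIndependent_add_smul hw _), Fintype.card_fin]
    omega

/-- A vector outside the kernel of a covector is the first one of a basis. -/
theorem exists_linearIndependent_cons [FiniteDimensional ℝ V] (hV : Module.finrank ℝ V = m + 1)
    {l : V →ₗ[ℝ] ℝ} (hl : l ξ ≠ 0) :
    ∃ w : Fin m → V, LinearIndependent ℝ (Fin.cons ξ w : Fin (m + 1) → V) := by
  have h0 : l ≠ 0 := fun h0 => hl (by simp [h0])
  have h1 := Module.Dual.finrank_ker_add_one_of_ne_zero h0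
  let b := Module.finBasisOfFinrankEq ℝ (LinearMap.ker l) (n := m) (by omega)
  refine ⟨fun a => b a, LinearIndependent.finCons
    (b.linearIndependent.map' (LinearMap.ker l).subtype (Submodule.ker_subtype _)) fun h => hl ?_⟩
  have h2 : Submodule.span ℝ (range fun a => (b a : V)) ≤ LinearMap.ker l := by
    rw [Submodule.span_le]
    rintro _ ⟨a, rfl⟩
    exact (b a).2
  exact h2 h

end Kernel

/-! ### Isotropic frames -/

namespace LightlikeHypersurface

variable {m : ℕ} {H : LightlikeHypersurface.{u} m} {J : H.V → ℝ} {x : H.V}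

instance (x : H.V) : FiniteDimensional ℝ (H.V.T x) :=
  inferInstanceAs (FiniteDimensional ℝ (Coord (m + 1)))

theorem finrank_tangentSpace (x : H.V) : Module.finrank ℝ (H.V.T x) = m + 1 :=
  finrank_euclideanSpace_fin (𝕜 := ℝ) (n := m + 1)

namespace IsotropicFrame

variable (f : H.IsotropicFrame x)

theorem e₁_ne_zero : f.e₁ ≠ 0 := f.linearIndependent.ne_zero 0

theorem exists_repr (v : H.V.T x) :
    ∃ (t : ℝ) (s : Fin m → ℝ), v = t • f.e₁ + ∑ b, s b • f.e b := by
  have h := f.linearIndependent.span_eq_top_of_card_eq_finrank (by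
    rw [Fintype.card_fin, finrank_tangentSpace])
  obtain ⟨c, hc⟩ := (Submodule.mem_span_range_iff_exists_fun ℝ).1
    (h.ge (Submodule.mem_top (x := v)))
  refine ⟨c 0, fun b => c b.succ, ?_⟩
  rw [← hc, Fin.sum_univ_succ]
  simp

theorem d_e₁_ne_zero (hJ : H.LevelsTransversal J) : H.d J x f.e₁ ≠ 0 :=
  hJ x _ f.e₁_mem f.e₁_ne_zero

theorem screen_eq_levelDist (hJ : H.LevelsTransversal J) :
    f.screen (fun a => -(H.d J x (f.e a)) / H.d J x f.e₁) = H.levelDist J x :=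
  span_add_smul_eq_ker (l := (H.d J x).toLinearMap) (finrank_tangentSpace x)
    f.linearIndependent (f.d_e₁_ne_zero hJ)

theorem en_not_tangent (v : H.V.T x) : H.dι x v ≠ f.en := by
  intro hv
  have h1 := f.en_e₁
  rw [← hv] at h1
  have h2 := f.e₁_mem v
  rw [h1] at h2
  norm_num at h2

end IsotropicFrame

theorem leviCivita_add (κ : H.AmbientChart) (χ : H.Chart) (X : ∀ x : H.V, H.M.T (H.ι x)) (x : H.V)
    (v w : H.V.T x) :
    H.leviCivita κ χ X x (v + w) = H.leviCivita κ χ X x v + H.leviCivita κ χ X x w := by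
  simp only [leviCivita, map_add, christoffel_add_left]
  exact add_add_add_comm _ _ _ _

theorem leviCivita_smul (κ : H.AmbientChart) (χ : H.Chart) (X : ∀ x : H.V, H.M.T (H.ι x))
    (x : H.V) (c : ℝ) (v : H.V.T x) :
    H.leviCivita κ χ X x (c • v) = c • H.leviCivita κ χ X x v := by
  simp only [leviCivita, map_smul, christoffel_smul_left, ← smul_add]

theorem leviCivita_sum (κ : H.AmbientChart) (χ : H.Chart) (X : ∀ x : H.V, H.M.T (H.ι x))
    (x : H.V) (s : Fin m → ℝ) (e : Fin m → H.V.T x) :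
    H.leviCivita κ χ X x (∑ b, s b • e b) = ∑ b, s b • H.leviCivita κ χ X x (e b) := by
  let L : H.V.T x →ₗ[ℝ] H.M.T (H.ι x) :=
    { toFun := H.leviCivita κ χ X x
      map_add' := leviCivita_add κ χ X x
      map_smul' := leviCivita_smul κ χ X x }
  have h : L (∑ b, s b • e b) = ∑ b, s b • L (e b) := by simp only [map_sum, map_smul]
  exact h

/-- The components of a vector of the ambient space in an isotropic frame; the one of `e₁` is
`-(X, e_n)`. -/
theorem IsotropicFrame.exists_repr_ambient (f : H.IsotropicFrame x) (hJ : H.LevelsTransversal J)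
    (X : H.M.T (H.ι x)) : ∃ (c : Fin m → ℝ) (d : ℝ),
      X = (-H.scal x X f.en) • H.dι x f.e₁ + ∑ b, c b • H.dι x (f.e b) + d • f.en := by
  obtain ⟨v, d, hX⟩ := (hJ.isLightlikeTriple x).exists_decomposition f.en_not_tangent X
  obtain ⟨t, c, rfl⟩ := f.exists_repr v
  have hX' : X = t • H.dι x f.e₁ + ∑ b, c b • H.dι x (f.e b) + d • f.en := by
    have h1 : H.dι x (t • f.e₁ + ∑ b, c b • f.e b) =
        t • H.dι x f.e₁ + ∑ b, c b • H.dι x (f.e b) := by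
      simp only [map_add, map_smul, map_sum]
    exact hX.trans (congrArg (· + d • f.en) h1)
  have ht : -H.scal x X f.en = t := by
    have h1 := f.en_e₁
    have h2 := f.en_e
    have h3 := f.en_isotropic
    rw [hX']
    simp only [scal, map_add, map_smul, map_sum, add_apply, smul_apply, sum_apply] at h1 h2 h3 ⊢
    simp only [h1, h2, h3, smul_eq_mul, mul_zero, Finset.sum_const_zero]
    ring
  exact ⟨c, d, by rw [ht]; exact hX'⟩

/-- If the fields `e_a` are tangent to the level submanifolds, so are their brackets. Hence the
brackets have no component along `e₁`, and as the Levi-Civita connection is torsion-free, the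
coefficients `ν_ab` are symmetric. -/
theorem IsChartPair.exists_connectionCoeff {κ : H.AmbientChart} {χ : H.Chart}
    (h : H.IsChartPair κ χ x) (hJ : ContMDiff 𝓘(ℝ, Coord (m + 1)) 𝓘(ℝ, ℝ) ∞ J)
    (hJt : H.LevelsTransversal J) {O : Set H.V} (hO : IsOpen O) (hxO : x ∈ O)
    (f : ∀ x : H.V, H.IsotropicFrame x)
    (hf : ∀ a, H.V.SmoothFieldOn (fun x => (f x).e a) O)
    (hS : ∀ x ∈ O, ∀ a, (f x).e a ∈ H.levelDist J x) :
    ∃ (ν : Fin m → ℝ) (ν₂ : Fin m → Fin m → ℝ),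
      H.IsConnectionCoeff κ χ f x ν ν₂ ∧ ∀ a b, ν₂ a b = ν₂ b a := by
  let D : Fin m → H.V.T x → H.M.T (H.ι x) := fun a v =>
    H.leviCivita κ χ (fun x' => H.dι x' ((f x').e a)) x v
  refine ⟨fun a => -H.scal x (D a (f x).e₁) (f x).en,
    fun a b => -H.scal x (D a ((f x).e b)) (f x).en, fun a t s => ?_, fun a b => ?_⟩
  · obtain ⟨c, d, hcd⟩ := (f x).exists_repr_ambient hJt (D a (t • (f x).e₁ + ∑ b, s b • (f x).e b))
    refine ⟨c, d, hcd.trans ?_⟩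
    congr 3
    simp only [D]
    rw [leviCivita_add, leviCivita_smul, leviCivita_sum]
    simp only [scal, map_add, map_smul, map_sum, add_apply, smul_apply, sum_apply, smul_eq_mul,
      neg_add, ← Finset.sum_neg_distrib]
    congr 1
    · ring
    · exact Finset.sum_congr rfl fun b _ => by ring
  · have hy : ∀ a, DifferentiableAt ℝ (fieldInCoord χ fun x => (f x).e a) (χ x) := fun a =>
      ((hf a).contDiffAt_toCoord h.right_mem hO hxO h.mem_source).differentiableAt (by simp)
    have hj : ContDiffAt ℝ ∞ (fun u => J (χ.symm u)) (χ x) :=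
      (hJ.contMDiffAt.comp (χ x) (contMDiffAt_symm_of_mem_maximalAtlas h.right_mem
        (χ.map_source h.mem_source))).contDiffAt
    let y : Fin m → Coord (m + 1) := fun a => H.V.toCoord χ x ((f x).e a)
    let b' : Fin m → Fin m → Coord (m + 1) := fun a b =>
      fderiv ℝ (fieldInCoord χ fun x => (f x).e a) (χ x) (y b)
    have hyb : ∀ b, H.V.ofCoord χ x (y b) = (f x).e b := fun b =>
      SmoothMfd.ofCoord_toCoord h.right_mem h.mem_source _
    -- the bracket of `e_b` and `e_a`, in coordinates, is annihilated by `dJ`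
    have hker : fderiv ℝ (fun u => J (χ.symm u)) (χ x) (b' a b - b' b a) = 0 := by
      have h1 : ∀ a b, fderiv ℝ (fderiv ℝ (fun u => J (χ.symm u))) (χ x) (y b) (y a) +
          fderiv ℝ (fun u => J (χ.symm u)) (χ x) (b' a b) = 0 := by
        intro a b
        have h2 : (fun u => fderiv ℝ (fun u => J (χ.symm u)) u
            (fieldInCoord χ (fun x => (f x).e a) u)) =ᶠ[𝓝 (χ x)] fun _ => (0 : ℝ) := by
          have hs : ContinuousAt χ.symm (χ x) := χ.continuousAt_symm (χ.map_source h.mem_source)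
          filter_upwards [h.eventually_symm, hs.preimage_mem_nhds (t := O)
            (hO.mem_nhds (by rwa [χ.left_inv h.mem_source]))] with u hu huO
          have h3 := hu.2.fderiv_comp_symm hJ (fieldInCoord χ (fun x => (f x).e a) u)
          rw [χ.right_inv hu.1] at h3
          rw [h3, fieldInCoord, SmoothMfd.ofCoord_toCoord hu.2.right_mem hu.2.mem_source]
          exact hS _ huO a
        have h3 : DifferentiableAt ℝ (fderiv ℝ (fun u => J (χ.symm u))) (χ x) :=
          (hj.fderiv_right (m := 1) (by norm_cast)).differentiableAt (by simp)
        have h4 := (h3.hasFDerivAt.clm_apply (hy a).hasFDerivAt).unique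
          ((hasFDerivAt_const (𝕜 := ℝ) (0 : ℝ) (χ x)).congr_of_eventuallyEq h2)
        have h5 := DFunLike.congr_fun h4 (y b)
        rw [h.fieldInCoord_apply] at h5
        rw [add_comm]
        exact h5
      have h6 : fderiv ℝ (fderiv ℝ (fun u => J (χ.symm u))) (χ x) (y b) (y a) =
          fderiv ℝ (fderiv ℝ (fun u => J (χ.symm u))) (χ x) (y a) (y b) :=
        hj.isSymmSndFDerivAt (by simpa using ENat.LEInfty.out) _ _
      rw [map_sub]
      linarith [h1 a b, h1 b a]
    have hD : ∀ a b, D a ((f x).e b) = H.M.ofCoord κ (H.ι x)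
        ((H.connectionData J κ χ x).leviCivita (y b) (y a) (b' a b)) := fun a b => by
      rw [← hyb b]
      exact h.leviCivita_ofCoord J (hy a) (y b)
    -- the connection is torsion-free
    have hdiff : D a ((f x).e b) - D b ((f x).e a) =
        H.dι x (H.V.ofCoord χ x (b' a b - b' b a)) := by
      rw [hD, hD, ← map_sub, ← h.ofCoord_fderiv_ιInCoord]
      congr 1
      have h7 : fderiv ℝ (fderiv ℝ (H.ιInCoord κ χ)) (χ x) (y b) (y a) =
          fderiv ℝ (fderiv ℝ (H.ιInCoord κ χ)) (χ x) (y a) (y b) :=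
        h.contDiffAt_ιInCoord.isSymmSndFDerivAt (by simpa using ENat.LEInfty.out) _ _
      have h8 := christoffel_comm (g := H.g.inCoord κ) (y := κ (H.ι x))
        (fun y v w => by rw [H.g.inCoord_apply_symm, H.g.form_symm]; rfl)
        (h.contDiffAt_inCoord.differentiableAt (by simp))
        (fderiv ℝ (H.ιInCoord κ χ) (χ x) (y b)) (fderiv ℝ (H.ιInCoord κ χ) (χ x) (y a))
      rw [christoffel_eq, christoffel_eq] at h8
      simp only [ConnectionData.leviCivita, connectionData]
      rw [h7, h8, map_sub]
      abel
    obtain ⟨t, s, hts⟩ := (f x).exists_repr (H.V.ofCoord χ x (b' a b - b' b a))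
    have ht : t = 0 := by
      rw [h.fderiv_comp_symm hJ, hts, map_add, map_smul, map_sum, Finset.sum_eq_zero, add_zero,
        smul_eq_mul] at hker
      · exact (mul_eq_zero.1 hker).resolve_right ((f x).d_e₁_ne_zero hJt)
      · intro c _
        rw [map_smul, mem_levelDist.1 (hS x hxO c), smul_zero]
    have h9 : H.scal x (D a ((f x).e b) - D b ((f x).e a)) (f x).en = 0 := by
      have h10 := (f x).en_e
      rw [hdiff, hts, ht]
      simp only [scal, zero_smul, zero_add, map_smul, map_sum, smul_apply, sum_apply] at h10 ⊢
      simp only [h10, smul_zero, Finset.sum_const_zero]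
    simp only [scal, map_sub, sub_apply] at h9
    simp only [scal]
    linarith

end LightlikeHypersurface

/-! ### The level submanifolds -/

/-- Every vector annihilated by the differential of a smooth function without critical point is the
velocity of a curve in a level set: the line in direction `v` is corrected in a transversal
direction `ξ` by the implicit function theorem. -/
theorem ContDiffAt.exists_curve_of_fderiv_eq_zero {F : Type*} [NormedAddCommGroup F]
    [NormedSpace ℝ F] {j : F → ℝ} {u v ξ : F} (hj : ContDiffAt ℝ ∞ j u) (hv : fderiv ℝ j u v = 0)
    (hξ : fderiv ℝ j u ξ ≠ 0) : ∃ c : ℝ → F, c 0 = u ∧ ContDiffAt ℝ ∞ c 0 ∧ HasDerivAt c v 0 ∧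
      ∀ᶠ t in 𝓝 0, j (c t) = j u := by
  let Φ : ℝ × ℝ → ℝ := fun p => j (u + p.1 • v + p.2 • ξ)
  let A : ℝ × ℝ →L[ℝ] F := (ContinuousLinearMap.fst ℝ ℝ ℝ).smulRight v +
    (ContinuousLinearMap.snd ℝ ℝ ℝ).smulRight ξ
  have hA : ∀ p : ℝ × ℝ, u + p.1 • v + p.2 • ξ = u + A p := fun p => by simp [A, add_assoc]
  have hΦ : Φ = fun p => j (u + A p) := funext fun p => congrArg j (hA p)
  have hj0 : ContDiffAt ℝ ∞ j (u + A (0, 0)) := by simpa [A] using hj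
  have hc : ContDiffAt ℝ ∞ Φ (0, 0) := by
    rw [hΦ]
    exact hj0.comp (0, 0) (contDiffAt_const.add A.contDiff.contDiffAt)
  have hd : fderiv ℝ Φ (0, 0) = fderiv ℝ j u ∘L A := by
    rw [hΦ]
    have h1 := (hj0.differentiableAt (by simp)).hasFDerivAt.comp ((0, 0) : ℝ × ℝ)
      (A.hasFDerivAt.const_add u)
    have h2 : u + A (0, 0) = u := by simp [A]
    rw [h2] at h1
    exact h1.fderiv
  have h1 : fderiv ℝ Φ (0, 0) ∘L .inl ℝ ℝ ℝ = 0 := by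
    rw [hd]
    ext
    simp [A, hv]
  have h2 : (fderiv ℝ Φ (0, 0) ∘L .inr ℝ ℝ ℝ).IsInvertible := by
    refine ⟨ContinuousLinearEquiv.unitsEquivAut ℝ (Units.mk0 _ hξ), ?_⟩
    rw [hd]
    ext
    simp [A]
  let ψ := hc.implicitFunction (by simp) h2
  have hψ0 : ψ 0 = 0 := hc.implicitFunction_apply_self (by simp) h2
  have hψ : ContDiffAt ℝ ∞ ψ 0 := hc.contDiffAt_implicitFunction (by simp) h2
  have hψd : HasDerivAt ψ 0 0 := by
    have h3 := (hc.hasStrictFDerivAt_implicitFunction (by simp) h2).hasFDerivAt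
    rw [h1, ContinuousLinearMap.comp_zero] at h3
    simpa using! h3.hasDerivAt
  refine ⟨fun t => u + t • v + ψ t • ξ, by simp [hψ0], ?_, ?_, ?_⟩
  · exact (contDiffAt_const.add (contDiffAt_id.smul contDiffAt_const)).add
      (hψ.smul contDiffAt_const)
  · have h3 := (((hasDerivAt_id (0 : ℝ)).smul_const v).const_add u).add (hψd.smul_const ξ)
    rw [one_smul, zero_smul, add_zero] at h3
    exact h3
  · filter_upwards [hc.eventually_apply_implicitFunction (by simp) h2] with t ht
    exact ht.trans (by simp [Φ])

namespace LightlikeHypersurface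

variable {m : ℕ} {H : LightlikeHypersurface.{u} m} {J : H.V → ℝ}

theorem isChartPair_chartAt (x : H.V) :
    H.IsChartPair (chartAt (Coord (m + 2)) (H.ι x)) (chartAt (Coord (m + 1)) x) x :=
  ⟨IsManifold.chart_mem_maximalAtlas _, IsManifold.chart_mem_maximalAtlas _,
    mem_chart_source _ _, mem_chart_source _ _⟩

theorem levelTangent_subset (hJ : ContMDiff 𝓘(ℝ, Coord (m + 1)) 𝓘(ℝ, ℝ) ∞ J) (x : H.V) :
    H.levelTangent J x ⊆ (H.levelDist J x : Set (H.V.T x)) := by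
  rintro v ⟨γ, rfl, hγ, hc, rfl⟩
  have h1 : MDifferentiableAt 𝓘(ℝ, Coord (m + 1)) 𝓘(ℝ, ℝ) J (γ 0) :=
    hJ.contMDiffAt.mdifferentiableAt (by simp)
  have h2 : MDifferentiableAt 𝓘(ℝ, ℝ) 𝓘(ℝ, Coord (m + 1)) γ 0 := hγ.mdifferentiableAt (by simp)
  have h3 := mfderiv_comp (0 : ℝ) h1 h2
  have h4 : (J ∘ γ) =ᶠ[𝓝 0] fun _ => J (γ 0) := hc
  rw [h4.mfderiv_eq, mfderiv_const] at h3
  exact (DFunLike.congr_fun h3 (1 : ℝ)).symm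

theorem LevelsTransversal.levelTangent_eq (hJt : H.LevelsTransversal J)
    (hJ : ContMDiff 𝓘(ℝ, Coord (m + 1)) 𝓘(ℝ, ℝ) ∞ J) (x : H.V) :
    H.levelTangent J x = (H.levelDist J x : Set (H.V.T x)) := by
  refine (levelTangent_subset hJ x).antisymm fun v hv => ?_
  have h := isChartPair_chartAt x
  set χ := chartAt (Coord (m + 1)) x
  have hu := χ.map_source h.mem_source
  have hs := contMDiffAt_symm_of_mem_maximalAtlas h.right_mem hu
  have hj : ContDiffAt ℝ ∞ (fun u => J (χ.symm u)) (χ x) :=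
    (hJ.contMDiffAt.comp (χ x) hs).contDiffAt
  have hv' : fderiv ℝ (fun u => J (χ.symm u)) (χ x) (H.V.toCoord χ x v) = 0 := by
    rw [h.fderiv_comp_symm hJ, SmoothMfd.ofCoord_toCoord h.right_mem h.mem_source]
    exact hv
  obtain ⟨ξ, hξ0, hξ⟩ := (h.isLightlikeTriple hJ hJt).exists_radical
  obtain ⟨c, hc0, hc, hcd, hcj⟩ := hj.exists_curve_of_fderiv_eq_zero hv'
    ((h.isLightlikeTriple hJ hJt).transversal ξ hξ hξ0)
  have hs0 : ContMDiffAt 𝓘(ℝ, Coord (m + 1)) 𝓘(ℝ, Coord (m + 1)) ∞ χ.symm (c 0) := by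
    rw [hc0]
    exact hs
  refine ⟨fun t => χ.symm (c t), (congrArg χ.symm hc0).trans (χ.left_inv h.mem_source),
    hs0.comp 0 hc.contMDiffAt, ?_, ?_⟩
  · filter_upwards [hcj] with t ht
    rw [ht, χ.left_inv h.mem_source]
  · have h1 := mfderiv_comp (0 : ℝ) (hs0.mdifferentiableAt (by simp))
      (hc.contMDiffAt.mdifferentiableAt (by simp))
    have h2 : (mfderiv 𝓘(ℝ, ℝ) 𝓘(ℝ, Coord (m + 1)) c 0 (1 : ℝ) : Coord (m + 1)) =
        H.V.toCoord χ x v := by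
      rw [mfderiv_eq_fderiv]
      exact (DFunLike.congr_fun hcd.hasFDerivAt.fderiv (1 : ℝ)).trans (by simp)
    refine (DFunLike.congr_fun h1 (1 : ℝ)).trans ?_
    refine (congrArg _ h2).trans ?_
    rw [hc0]
    have h3 := DFunLike.congr_fun (SmoothMfd.ofCoord_eq_mfderiv_symm h.right_mem h.mem_source)
      (H.V.toCoord χ x v)
    exact h3.symm.trans (SmoothMfd.ofCoord_toCoord h.right_mem h.mem_source v)

/-! ### The screen distribution -/

theorem LevelsTransversal.isCompl (hJt : H.LevelsTransversal J) (x : H.V) :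
    IsCompl (H.isotropic x) (H.levelDist J x) := by
  have t := hJt.isLightlikeTriple x
  refine ⟨Submodule.disjoint_def.2 fun v hv hv' => t.eq_zero_of_radical hv hv',
    codisjoint_iff.2 (eq_top_iff.2 fun v _ => ?_)⟩
  obtain ⟨ξ, hξ0, hξ⟩ := H.lightlike x
  have hd := hJt x ξ hξ hξ0
  refine Submodule.mem_sup.2 ⟨(H.d J x v / H.d J x ξ) • ξ, Submodule.smul_mem _ _ hξ,
    v - (H.d J x v / H.d J x ξ) • ξ, ?_, add_sub_cancel _ _⟩
  rw [mem_levelDist, map_sub, map_smul, smul_eq_mul, div_mul_cancel₀ _ hd, sub_self]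

theorem LevelsTransversal.isScreenDistribution (hJt : H.LevelsTransversal J)
    (hJ : ContMDiff 𝓘(ℝ, Coord (m + 1)) 𝓘(ℝ, ℝ) ∞ J) :
    H.IsScreenDistribution (H.levelDist J) := by
  refine ⟨hJt.isCompl, fun x₀ => ?_⟩
  have h := isChartPair_chartAt x₀
  set κ := chartAt (Coord (m + 2)) (H.ι x₀)
  set χ := chartAt (Coord (m + 1)) x₀
  obtain ⟨ξ, hξ0, hξ⟩ := (h.isLightlikeTriple hJ hJt).exists_radical
  -- the constant fields `w_a` are corrected along the constant field `ξ`, which stays transversal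
  -- to the level submanifolds near `x₀`
  let l : Coord (m + 1) → Coord (m + 1) →L[ℝ] ℝ := fderiv ℝ (fun u => J (χ.symm u))
  have hl : l (χ x₀) ξ ≠ 0 := (h.isLightlikeTriple hJ hJt).transversal ξ hξ hξ0
  obtain ⟨w, hw⟩ := exists_linearIndependent_cons (m := m) (V := Coord (m + 1)) (by simp)
    (l := (l (χ x₀)).toLinearMap) hl
  let y : Fin m → Coord (m + 1) → Coord (m + 1) := fun a u =>
    w a + (-(l u (w a)) / l u ξ) • ξ
  have hlc : ∀ x, H.IsChartPair κ χ x → ContDiffAt ℝ ∞ l (χ x) := fun x hx =>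
    ContDiffAt.fderiv_right (m := ∞) (n := ∞) (hJ.contMDiffAt.comp (χ x)
      (contMDiffAt_symm_of_mem_maximalAtlas hx.right_mem
        (χ.map_source hx.mem_source))).contDiffAt (by simp)
  have hyc : ∀ x, H.IsChartPair κ χ x → l (χ x) ξ ≠ 0 → ∀ a, ContDiffAt ℝ ∞ (y a) (χ x) :=
    fun x hx hxξ a => contDiffAt_const.add (((((hlc x hx).clm_apply contDiffAt_const).neg).div
      ((hlc x hx).clm_apply contDiffAt_const) hxξ).smul contDiffAt_const)
  have hev : ∀ᶠ x in 𝓝 x₀, H.IsChartPair κ χ x ∧ l (χ x) ξ ≠ 0 := by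
    have h1 : ContinuousAt (fun x => l (χ x) ξ) x₀ :=
      ContinuousAt.comp (f := χ) (g := fun u => l u ξ)
        ((hlc x₀ h).clm_apply contDiffAt_const).continuousAt (χ.continuousAt h.mem_source)
    filter_upwards [χ.open_source.mem_nhds h.mem_source,
      H.contMDiff.continuous.continuousAt.preimage_mem_nhds (κ.open_source.mem_nhds h.ι_mem_source),
      h1.eventually_ne hl] with x hx hx' hxξ
    exact ⟨⟨h.left_mem, h.right_mem, hx, hx'⟩, hxξ⟩
  obtain ⟨O, hO, hOo, hxO⟩ := eventually_nhds_iff.1 hev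
  refine ⟨O, hOo, hxO, fun a x => H.V.ofCoord χ x (y a (χ x)), fun a x hx => ?_, fun x hx => ?_⟩
  · have hx' := (hO x hx).1
    have h1 := (SmoothMfd.contMDiffAt_ofCoord hx'.right_mem (χ.map_source hx'.mem_source)
      (hyc x hx' (hO x hx).2 a)).comp x
        (contMDiffAt_of_mem_maximalAtlas hx'.right_mem hx'.mem_source)
    refine (h1.congr_of_eventuallyEq ?_).contMDiffWithinAt
    filter_upwards [χ.open_source.mem_nhds hx'.mem_source] with x' hx'
    simp only [Function.comp_apply]
    rw [χ.left_inv hx']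
  · have hx' := (hO x hx).1
    have h1 := linearIndependent_add_smul hw fun a => -(l (χ x) (w a)) / l (χ x) ξ
    have h2 := span_add_smul_eq_ker (V := Coord (m + 1)) (by simp) hw
      (l := (l (χ x)).toLinearMap) (hO x hx).2
    refine ⟨h1.map' (H.V.ofCoord χ x).toLinearMap (LinearMap.ker_eq_bot.2
      (SmoothMfd.ofCoord_injective hx'.right_mem hx'.mem_source)), ?_⟩
    have h3 : Submodule.span ℝ (range fun a => H.V.ofCoord χ x (y a (χ x))) =
        (LinearMap.ker (l (χ x)).toLinearMap).map (H.V.ofCoord χ x).toLinearMap := by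
      rw [← h2, Submodule.map_span, ← range_comp]
      rfl
    refine h3.trans ?_
    ext v
    refine ⟨?_, fun hv => ⟨H.V.toCoord χ x v, ?_, ?_⟩⟩
    · rintro ⟨u, hu, rfl⟩
      exact (hx'.fderiv_comp_symm hJ u).symm.trans hu
    · refine (hx'.fderiv_comp_symm hJ _).trans ?_
      rw [SmoothMfd.ofCoord_toCoord hx'.right_mem hx'.mem_source]
      exact hv
    · exact SmoothMfd.ofCoord_toCoord hx'.right_mem hx'.mem_source v

theorem LevelsTransversal.exists_normalizing_unique (hJt : H.LevelsTransversal J) (x : H.V) :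
    ∃ N, H.IsNormalizing (H.levelDist J) x N ∧
      ∀ N', H.IsNormalizing (H.levelDist J) x N' → ∃ c : ℝ, c ≠ 0 ∧ N' = c • N :=
  ⟨_, hJt.isNormalizing_nullNormal x, fun _ hN => hJt.exists_smul_nullNormal hN⟩

/-- A local isometry preserving `J` maps the kernel of its differential onto the kernel of its
differential. -/
theorem LocalIsometry.map_levelDist {H H' : LightlikeHypersurface.{u} m} (L : LocalIsometry H H')
    {J : H.V → ℝ} {J' : H'.V → ℝ} (hJ' : ContMDiff 𝓘(ℝ, Coord (m + 1)) 𝓘(ℝ, ℝ) ∞ J')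
    (hL : ∀ x ∈ L.Ψ.source, J' (L.Ψ x) = J x) {x : H.V} (hx : x ∈ L.Ψ.source) :
    (H.levelDist J x).map
      (mfderiv 𝓘(ℝ, Coord (m + 1)) 𝓘(ℝ, Coord (m + 1)) L.Ψ x).toLinearMap =
      H'.levelDist J' (L.Ψ x) := by
  have hΨ : L.Ψ.MDifferentiable 𝓘(ℝ, Coord (m + 1)) 𝓘(ℝ, Coord (m + 1)) :=
    ⟨L.smooth_Ψ.mdifferentiableOn (by simp), L.smooth_Ψ_symm.mdifferentiableOn (by simp)⟩
  have hd : ∀ v, H.d J x v = H'.d J' (L.Ψ x)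
      (mfderiv 𝓘(ℝ, Coord (m + 1)) 𝓘(ℝ, Coord (m + 1)) L.Ψ x v) := fun v => by
    have h1 : (J' ∘ L.Ψ) =ᶠ[𝓝 x] J := by
      filter_upwards [L.Ψ.open_source.mem_nhds hx] with y hy using hL y hy
    have h2 := mfderiv_comp x (hJ'.contMDiffAt.mdifferentiableAt (by simp))
      (hΨ.mdifferentiableAt hx)
    rw [h1.mfderiv_eq] at h2
    exact DFunLike.congr_fun h2 v
  ext w
  refine ⟨?_, fun hw => ?_⟩
  · rintro ⟨v, hv, rfl⟩
    exact (hd v).symm.trans hv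
  · obtain ⟨v, rfl⟩ := hΨ.mfderiv_surjective hx w
    exact ⟨v, (hd v).trans hw, rfl⟩

end LightlikeHypersurface

theorem theorem5 (m : ℕ) (𝒞 : Set (LightlikeHypersurface.{u} m)) (J : AbsoluteInvariant.{u} m)
    (hJ : ∀ H ∈ 𝒞, ContMDiff 𝓘(ℝ, Coord (m + 1)) 𝓘(ℝ, ℝ) ∞ (J H))
    (htrans : ∀ H ∈ 𝒞, H.LevelsTransversal (J H)) :
    -- the distribution tangent to the level submanifolds is a screen distribution
    (∀ H ∈ 𝒞, (∀ x, H.levelTangent (J H) x = (H.levelDist (J H) x : Set (H.V.T x))) ∧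
      H.IsScreenDistribution (H.levelDist (J H))) ∧
    -- it is invariant: given in every isotropic frame by the normalizing object of `J`
    (∀ H ∈ 𝒞, ∀ x,
      H.IsNormalizingObject x (fun f a => -(H.d (J H) x (f.e a)) / H.d (J H) x f.e₁) ∧
      ∀ f : H.IsotropicFrame x,
        f.screen (fun a => -(H.d (J H) x (f.e a)) / H.d (J H) x f.e₁) = H.levelDist (J H) x) ∧
    -- it determines a normalization
    (∀ H ∈ 𝒞, ∀ x,
      (∃ N, H.IsNormalizing (H.levelDist (J H)) x N ∧
        ∀ N', H.IsNormalizing (H.levelDist (J H)) x N' → ∃ c : ℝ, c ≠ 0 ∧ N' = c • N) ∧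
      (∃! P, H.IsScreenProjection (H.levelDist (J H)) x P) ∧
      (∃! Q, H.IsTangentialProjection (H.levelDist (J H)) x Q)) ∧
    -- it is intrinsic if `J` is
    (J.IsIntrinsic 𝒞 → IsIntrinsicDistribution 𝒞 (fun H => H.levelDist (J H))) ∧
    -- orders of the normalization and of the curvature tensor of the induced connection
    (∀ (𝒦 : ∀ M : SmoothMfd.{u} (m + 2), Set (OpenPartialHomeomorph M (Coord (m + 2)))) (p : ℕ),
      HasOrder 𝒞 𝒦 p (fun H _ _ x => J H x) →
        HasOrder 𝒞 𝒦 (p + 1)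
          (fun H _ χ x => H.screenProjectionInCoord (H.levelDist (J H)) χ x) ∧
        HasOrder 𝒞 𝒦 (p + 1)
          (fun H κ χ x => H.tangentialProjectionInCoord (H.levelDist (J H)) κ χ x) ∧
        (1 ≤ p → ∀ v w z : Coord (m + 1), HasOrder 𝒞 𝒦 (p + 2)
          (fun H κ χ x => H.inducedCurvature (H.levelDist (J H)) κ χ v w z x))) ∧
    -- the induced connection has symmetric `ν_ab`
    (∀ H ∈ 𝒞, ∀ κ ∈ H.M.charts, ∀ χ ∈ H.V.charts, ∀ O : Set H.V, IsOpen O →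
      O ⊆ χ.source → (∀ x ∈ O, H.ι x ∈ κ.source) →
      ∀ f : ∀ x : H.V, H.IsotropicFrame x, H.SmoothFramesOn f O →
      (∀ x ∈ O, ∀ a, (f x).e a ∈ H.levelDist (J H) x) →
      ∀ x ∈ O, ∃ (ν : Fin m → ℝ) (ν₂ : Fin m → Fin m → ℝ),
        H.IsConnectionCoeff κ χ f x ν ν₂ ∧ ∀ a b, ν₂ a b = ν₂ b a) := by
  refine ⟨fun H hH => ⟨(htrans H hH).levelTangent_eq (hJ H hH),
      (htrans H hH).isScreenDistribution (hJ H hH)⟩,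
    fun H hH x => ⟨fun f f' => ?_, fun f => f.screen_eq_levelDist (htrans H hH)⟩,
    fun H hH x => ⟨(htrans H hH).exists_normalizing_unique x,
      ⟨_, (htrans H hH).isScreenProjection_iff.2 rfl,
        fun P hP => (htrans H hH).isScreenProjection_iff.1 hP⟩,
      ⟨_, (htrans H hH).isTangentialProjection_iff.2 rfl,
        fun Q hQ => (htrans H hH).isTangentialProjection_iff.1 hQ⟩⟩,
    fun hJi H hH H' hH' L x hx => L.map_levelDist (hJ H' hH') (hJi H hH H' hH' L) hx,
    fun 𝒦 p hJp => ⟨hasOrder_screenProjection hJ htrans hJp,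
      hasOrder_tangentialProjection hJ htrans hJp,
      fun hp v w z => hasOrder_inducedCurvature hJ htrans hp hJp v w z⟩,
    fun H hH κ hκ χ hχ O hO hOχ hOκ f hf hS x hx =>
      LightlikeHypersurface.IsChartPair.exists_connectionCoeff ⟨hκ, hχ, hOχ hx, hOκ x hx⟩
        (hJ H hH) (htrans H hH) hO hx f hf.2.1 hS⟩
  rw [f.screen_eq_levelDist (htrans H hH), f'.screen_eq_levelDist (htrans H hH)]

end
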